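/- Let $N^{+}=\mathbb{Z}_{\ge 0}^2\setminus\{(0,0)\}$, $\deg(a,b)=a+b$, and $\{(a,b),(c,d)\}=bc-ad$. Let $\mathfrak{g}=\bigoplus_{p\in N^{+}}\mathbb{Q}X_p$ be the Lie algebra over $\mathbb{Q}$ with $[X_p,X_q]=\{p,q\}X_{p+q}$. For $l\ge 0$ let $\mathfrak{g}^{\le l}=\mathfrak{g}/\bigoplus_{\deg p>l}\mathbb{Q}X_p$, let $G^{\le l}=\{\exp(X): X\in\mathfrak{g}^{\le l}\}$ be the group whose product is given by the Baker–Campbell–Hausdorff formula, and let $G=\varprojlim_l G^{\le l}$. For $c\in\mathbb{Q}$ put $\exp(X)^c=\exp(cX)$, and for $p\in N^{+}$ put $$\Psi[p]=\exp\Bigl(\sum_{j\ge 1}\frac{(-1)^{j+1}}{j^2}X_{jp}\Bigr)\in G .$$ Order $N^{+}$ totally by: $p\le q$ if and only if $\{p,q\}<0$, or $q=kp$ for some rational $k\ge 1$. For $m,n\in\mathbb{Z}_{\ge 0}$, there is exactly one family of rational numbers $\bigl(u_{p}(m,n)\bigr)_{p\in N^{+}}$ such that $$\Psi[(0,1)]^{n}\,\Psi[(1,0)]^{m}=\prod_{p\in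 N^{+}}\Psi[p]^{u_p(m,n)}\quad\text{in } G,$$ where the factors on the right-hand side are ordered increasingly from left to right (the product is finite in each $G^{\le l}$). **Theorem.** For all integers $a\ge 1$ and $m,n\ge 0$, $$\begin{aligned} u_{(a,2)}(m,n)=\ &\sum_{\frac a2<k\le a}\left\lceil\frac{2k-a}{2}\right\rceil\binom{2k-a}{\left\lceil\frac{2k-a}{2}\right\rceil}\binom{k}{2k-a}\binom mk\binom n2\\ &+\sum_{\frac a2+1<k\le a}\left\{\frac{2k-a}{2}\binom{2k-a-1}{\left\lceil\frac{2k-a-1}{2}\right\rceil}-2^{2k-a-2}\right\}\binom{k}{2k-a}\binom mk\binom n1 , \end{aligned}$$ where $k$ runs over integers and $\lceil x\rceil$ is the least integer $\ge x$. -/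

import Mathlib

/-! ## The monoid `N⁺` -/

/-- `N⁺ = {(a, b) ∈ ℤ≥0² : (a, b) ≠ (0, 0)}`. -/
@[ext]
structure NPlus where
  a : ℕ
  b : ℕ
  pos : 0 < a + b

namespace NPlus

/-- The degree `deg (a, b) = a + b`. -/
def deg (p : NPlus) : ℕ := p.a + p.b

instance : Add NPlus where
  add p q := ⟨p.a + q.a, p.b + q.b, by have := p.pos; omega⟩

@[simp] theorem add_a (p q : NPlus) : (p + q).a = p.a + q.a := rfl
@[simp] theorem add_b (p q : NPlus) : (p + q).b = p.b + q.b := rfl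
@[simp] theorem deg_add (p q : NPlus) : (p + q).deg = p.deg + q.deg := by
  simp only [deg, add_a, add_b]; omega

theorem deg_pos (p : NPlus) : 0 < p.deg := p.pos

/-- The positive multiple `(j + 1) • p`. -/
def succMul (j : ℕ) (p : NPlus) : NPlus :=
  ⟨(j + 1) * p.a, (j + 1) * p.b, by
    have := p.pos
    rw [← Nat.mul_add]
    positivity⟩

theorem lt_deg_succMul (j : ℕ) (p : NPlus) : j < (succMul j p).deg := by
  have h := p.pos
  show j < (j + 1) * p.a + (j + 1) * p.b
  rw [← Nat.mul_add]
  nlinarith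

/-- The skew-symmetric form `{(a, b), (c, d)} = b c - a d`. -/
def form (p q : NPlus) : ℤ := (p.b : ℤ) * q.a - (p.a : ℤ) * q.b

/-- The order on `N⁺`: `p ≤ q` iff `{p, q} < 0` or `q = k p` for some rational `k ≥ 1`. -/
instance : LE NPlus where
  le p q := form p q < 0 ∨ ∃ k : ℚ, 1 ≤ k ∧ (q.a : ℚ) = k * p.a ∧ (q.b : ℚ) = k * p.b

theorem le_def (p q : NPlus) : p ≤ q ↔
    form p q < 0 ∨ ∃ k : ℚ, 1 ≤ k ∧ (q.a : ℚ) = k * p.a ∧ (q.b : ℚ) = k * p.b := Iff.rfl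

theorem le_iff (p q : NPlus) :
    p ≤ q ↔ form p q < 0 ∨ (form p q = 0 ∧ p.deg ≤ q.deg) := by
  rw [le_def]
  refine or_congr_right ⟨?_, ?_⟩
  · rintro ⟨k, hk, ha, hb⟩
    constructor
    · have : ((form p q : ℤ) : ℚ) = 0 := by
        simp only [form]; push_cast; rw [ha, hb]; ring
      exact_mod_cast this
    · have : (p.deg : ℚ) ≤ q.deg := by
        simp only [deg]; push_cast; rw [ha, hb]
        have h1 : (0 : ℚ) ≤ p.a := by positivity
        have h2 : (0 : ℚ) ≤ p.b := by positivity
        nlinarith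
      exact_mod_cast this
  · rintro ⟨h0, hd⟩
    have hp : (0 : ℚ) < p.deg := by exact_mod_cast p.deg_pos
    have hf : (p.b : ℚ) * q.a - p.a * q.b = 0 := by
      have := congrArg (Int.cast : ℤ → ℚ) h0
      simpa [form] using this
    have hdp : (p.deg : ℚ) = p.a + p.b := by simp [deg]
    have hdq : (q.deg : ℚ) = q.a + q.b := by simp [deg]
    refine ⟨q.deg / p.deg, ?_, ?_, ?_⟩
    · rw [le_div_iff₀ hp, one_mul]; exact_mod_cast hd
    · field_simp; rw [hdp, hdq]; linarith
    · field_simp; rw [hdp, hdq]; linarith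

theorem form_cocycle (p q r : NPlus) :
    (q.deg : ℤ) * form p r = r.deg * form p q + p.deg * form q r := by
  simp only [form, deg]; push_cast; ring

theorem form_antisymm (p q : NPlus) : form p q = -form q p := by
  simp only [form]; ring

open Classical in
noncomputable instance : LinearOrder NPlus where
  le_refl p := (le_iff p p).2 (Or.inr ⟨by simp only [form]; ring, le_rfl⟩)
  le_trans p q r hpq hqr := by
    rw [le_iff] at *
    have h := form_cocycle p q r
    have h1 : (0 : ℤ) < p.deg := by exact_mod_cast p.deg_pos
    have h2 : (0 : ℤ) < q.deg := by exact_mod_cast q.deg_pos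
    have h3 : (0 : ℤ) < r.deg := by exact_mod_cast r.deg_pos
    rcases hpq with hpq | ⟨hpq, hd⟩ <;> rcases hqr with hqr | ⟨hqr, hd'⟩
    · left; nlinarith [mul_neg_of_pos_of_neg h3 hpq, mul_neg_of_pos_of_neg h1 hqr]
    · left; rw [hqr] at h; nlinarith [mul_neg_of_pos_of_neg h3 hpq]
    · left; rw [hpq] at h; nlinarith [mul_neg_of_pos_of_neg h1 hqr]
    · right
      rw [hpq, hqr] at h
      refine ⟨?_, hd.trans hd'⟩
      rcases mul_eq_zero.1 (show (q.deg : ℤ) * form p r = 0 by rw [h]; ring) with h' | h'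
      · omega
      · exact h'
  le_antisymm p q hpq hqp := by
    rw [le_iff] at *
    have h := form_antisymm p q
    have hf : form p q = 0 := by rcases hpq with h' | ⟨h', -⟩ <;> rcases hqp with h'' | ⟨h'', -⟩ <;> omega
    have hd : p.deg = q.deg := by
      rcases hpq with h' | ⟨h', h1⟩ <;> rcases hqp with h'' | ⟨h'', h2⟩ <;> omega
    have h1 : (0 : ℤ) < p.deg := by exact_mod_cast p.deg_pos
    simp only [form] at hf
    have hd' : (p.a : ℤ) + p.b = q.a + q.b := by exact_mod_cast hd
    have hdp : (p.deg : ℤ) = p.a + p.b := by simp [deg]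
    have ha : (p.deg : ℤ) * ((p.a : ℤ) - q.a) = 0 := by
      rw [hdp]; linear_combination (p.a : ℤ) * hd' - hf
    have ha' : (p.a : ℤ) = q.a := by
      rcases mul_eq_zero.1 ha with h' | h' <;> omega
    ext <;> omega
  le_total p q := by
    rw [le_iff, le_iff]
    have h := form_antisymm p q
    omega
  toDecidableLE := Classical.decRel _

/-- The finite set `(N⁺)^{≤ l}`. -/
noncomputable def degLE (l : ℕ) : Finset NPlus :=
  ((Finset.range (l + 1) ×ˢ Finset.range (l + 1)).subtype
    (fun x : ℕ × ℕ => 0 < x.1 + x.2 ∧ x.1 + x.2 ≤ l)).map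
    ⟨fun x => ⟨x.1.1, x.1.2, x.2.1⟩, by
      rintro ⟨⟨x, y⟩, hx⟩ ⟨⟨z, w⟩, hz⟩ h
      simpa using h⟩

theorem mem_degLE (l : ℕ) (p : NPlus) : p ∈ degLE l ↔ p.deg ≤ l := by
  constructor
  · intro h
    simp only [degLE, Finset.mem_map, Finset.mem_subtype] at h
    obtain ⟨x, -, rfl⟩ := h
    exact x.2.2
  · intro h
    simp only [degLE, Finset.mem_map, Finset.mem_subtype]
    have h' : p.a + p.b ≤ l := h
    refine ⟨⟨(p.a, p.b), p.pos, h⟩, ?_, rfl⟩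
    simp only [Finset.mem_product, Finset.mem_range]
    omega

end NPlus

/-! ## The graded Lie algebra `𝔤` -/

/-- `𝔤 = ⨁_{n ∈ N⁺} ℚ X_n`. -/
def GradedLie : Type := NPlus →₀ ℚ

namespace GradedLie

noncomputable instance : AddCommGroup GradedLie := inferInstanceAs (AddCommGroup (NPlus →₀ ℚ))
noncomputable instance : Module ℚ GradedLie := inferInstanceAs (Module ℚ (NPlus →₀ ℚ))

/-- The coefficient of `X_p`. -/
noncomputable def coeff (p : NPlus) : GradedLie →ₗ[ℚ] ℚ := Finsupp.lapply (M := ℚ) (R := ℚ) p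

/-- The generator `X_n`. -/
noncomputable def X (n : NPlus) : GradedLie := Finsupp.single n (1 : ℚ)

/-- The bilinear map with `(X_p, X_q) ↦ {p, q} X_{p+q}`. -/
noncomputable def lieMap : GradedLie →ₗ[ℚ] GradedLie →ₗ[ℚ] GradedLie :=
  Finsupp.linearCombination ℚ (fun p : NPlus =>
    (Finsupp.linearCombination ℚ (fun q : NPlus => (NPlus.form p q : ℚ) • X (p + q)) :
      GradedLie →ₗ[ℚ] GradedLie))

theorem lieMap_X (p q : NPlus) : lieMap (X p) (X q) = (NPlus.form p q : ℚ) • X (p + q) := by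
  have h := Finsupp.linearCombination_single ℚ (1 : ℚ) p
    (v := fun p => Finsupp.linearCombination ℚ (fun q => (NPlus.form p q : ℚ) • X (p + q)))
  have h' := Finsupp.linearCombination_single ℚ (1 : ℚ) q
    (v := fun q => (NPlus.form p q : ℚ) • X (p + q))
  rw [one_smul] at h h'
  exact (LinearMap.congr_fun h (X q)).trans h'

theorem hom_ext {M : Type*} [AddCommGroup M] [Module ℚ M] {f g : GradedLie →ₗ[ℚ] M}
    (h : ∀ p, f (X p) = g (X p)) : f = g :=
  Finsupp.lhom_ext' (fun p => LinearMap.ext_ring (h p))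

noncomputable instance : Bracket GradedLie GradedLie := ⟨fun x y => lieMap x y⟩

theorem lie_def (x y : GradedLie) : ⁅x, y⁆ = lieMap x y := rfl

theorem lieMap_swap (x y : GradedLie) : lieMap x y = -lieMap y x := by
  have : lieMap = -lieMap.flip := by
    refine hom_ext fun p => hom_ext fun q => ?_
    rw [LinearMap.neg_apply, LinearMap.neg_apply, LinearMap.flip_apply, lieMap_X, lieMap_X,
      NPlus.form_antisymm p q, show p + q = q + p by ext <;> simp [add_comm]]
    simp
  conv_lhs => rw [this]
  rfl

theorem lieMap_jacobi (x y z : GradedLie) :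
    lieMap x (lieMap y z) = lieMap (lieMap x y) z + lieMap y (lieMap x z) := by
  have h1 : ∀ p q z, lieMap (X p) (lieMap (X q) z) =
      lieMap (lieMap (X p) (X q)) z + lieMap (X q) (lieMap (X p) z) := by
    intro p q z
    have : (lieMap (X p)).comp (lieMap (X q)) =
        lieMap (lieMap (X p) (X q)) + (lieMap (X q)).comp (lieMap (X p)) := by
      refine hom_ext fun r => ?_
      simp only [LinearMap.comp_apply, LinearMap.add_apply, lieMap_X, map_smul,
        LinearMap.smul_apply, smul_smul]
      rw [show p + (q + r) = p + q + r by ext <;> simp [add_assoc],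
        show q + (p + r) = p + q + r by ext <;> simp <;> omega, ← add_smul]
      congr 1
      simp only [NPlus.form, NPlus.add_a, NPlus.add_b]
      push_cast
      ring
    exact LinearMap.congr_fun this z
  have h2 : ∀ p y z, lieMap (X p) (lieMap y z) =
      lieMap (lieMap (X p) y) z + lieMap y (lieMap (X p) z) := by
    intro p y z
    have : (lieMap (X p)).comp (lieMap.flip z) =
        (lieMap.flip z).comp (lieMap (X p)) + lieMap.flip (lieMap (X p) z) := by
      refine hom_ext fun q => ?_
      simpa using h1 p q z
    exact LinearMap.congr_fun this y
  have : lieMap.flip (lieMap y z) =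
      (lieMap.flip z).comp (lieMap.flip y) + (lieMap y).comp (lieMap.flip z) := by
    refine hom_ext fun p => ?_
    simpa using h2 p y z
  exact LinearMap.congr_fun this x

noncomputable instance : LieRing GradedLie where
  add_lie x y z := by simp [lie_def]
  lie_add x y z := by simp [lie_def]
  lie_self x := by
    have h := lieMap_swap x x
    rw [lie_def]
    have h2 : (2 : ℚ) • lieMap x x = 0 := by
      rw [two_smul]; nth_rewrite 2 [h]; exact add_neg_cancel _
    exact (smul_eq_zero.1 h2).resolve_left two_ne_zero
  leibniz_lie x y z := lieMap_jacobi x y z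

noncomputable instance : LieAlgebra ℚ GradedLie where
  lie_smul t x y := by simp [lie_def]

theorem lie_X (p q : NPlus) : ⁅X p, X q⁆ = (NPlus.form p q : ℚ) • X (p + q) := lieMap_X p q

theorem eq_top_of_X_mem (S : Submodule ℚ GradedLie) (h : ∀ n, X n ∈ S) : S = ⊤ := by
  have h0 : S.mkQ = 0 := hom_ext fun n => by simpa using h n
  rw [← S.ker_mkQ, h0, LinearMap.ker_zero]

/-- The subspace `𝔤^{> l} = ⨁_{deg n > l} ℚ X_n`. -/
noncomputable def gtSubmodule (l : ℕ) : Submodule ℚ GradedLie :=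
  Submodule.span ℚ (X '' {n | l < n.deg})

theorem X_mem_gtSubmodule {l : ℕ} {n : NPlus} (h : l < n.deg) : X n ∈ gtSubmodule l :=
  Submodule.subset_span ⟨n, h, rfl⟩

theorem lie_mem_gtSubmodule {l : ℕ} (x : GradedLie) {y : GradedLie} (hy : y ∈ gtSubmodule l) :
    ⁅x, y⁆ ∈ gtSubmodule (l + 1) := by
  have key : ∀ q : NPlus, l < q.deg → ∀ x : GradedLie, ⁅x, X q⁆ ∈ gtSubmodule (l + 1) := by
    intro q hq x
    have := eq_top_of_X_mem ((gtSubmodule (l + 1)).comap (lieMap.flip (X q))) (fun p => by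
      rw [Submodule.mem_comap, LinearMap.flip_apply, lieMap_X]
      refine Submodule.smul_mem _ _ (X_mem_gtSubmodule ?_)
      have := p.deg_pos
      rw [NPlus.deg_add]; omega)
    exact (this ▸ Submodule.mem_top : x ∈ (gtSubmodule (l + 1)).comap (lieMap.flip (X q)))
  have : gtSubmodule l ≤ (gtSubmodule (l + 1)).comap (lieMap x) := by
    refine Submodule.span_le.2 ?_
    rintro _ ⟨q, hq, rfl⟩
    exact key q hq x
  exact this hy

theorem gtSubmodule_mono {l l' : ℕ} (h : l ≤ l') : gtSubmodule l' ≤ gtSubmodule l :=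
  Submodule.span_mono (Set.image_mono fun _ hn => lt_of_le_of_lt h hn)

theorem gtSubmodule_zero : gtSubmodule 0 = ⊤ :=
  eq_top_of_X_mem _ fun n => X_mem_gtSubmodule n.deg_pos

/-- `𝔤^{> l}` as a Lie ideal. -/
noncomputable def gt (l : ℕ) : LieIdeal ℚ GradedLie where
  __ := gtSubmodule l
  lie_mem {x _} hy := gtSubmodule_mono (Nat.le_succ l) (lie_mem_gtSubmodule x hy)

theorem mem_gt {l : ℕ} {x : GradedLie} : x ∈ gt l ↔ x ∈ gtSubmodule l := Iff.rfl

/-- The quotient Lie algebra `𝔤^{≤ l} = 𝔤 / 𝔤^{> l}`. -/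
abbrev Le (l : ℕ) : Type := GradedLie ⧸ gt l

/-- The canonical projection `𝔤 → 𝔤^{≤ l}`. -/
noncomputable def toLe (l : ℕ) : GradedLie →ₗ⁅ℚ⁆ Le l where
  toFun := LieSubmodule.Quotient.mk
  map_add' _ _ := rfl
  map_smul' _ _ := rfl
  map_lie' {x y} := LieSubmodule.Quotient.mk_bracket (I := gt l) x y

theorem toLe_surjective (l : ℕ) : Function.Surjective (toLe l) :=
  Submodule.Quotient.mk_surjective (gtSubmodule l)

theorem toLe_eq_zero {l : ℕ} {x : GradedLie} : toLe l x = 0 ↔ x ∈ gtSubmodule l :=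
  Submodule.Quotient.mk_eq_zero (gtSubmodule l)

/-- The canonical projection `𝔤^{≤ l+1} → 𝔤^{≤ l}`. -/
noncomputable def proj (l : ℕ) : Le (l + 1) →ₗ⁅ℚ⁆ Le l where
  __ := Submodule.factor (gtSubmodule_mono (Nat.le_succ l))
  map_lie' {x y} := by
    obtain ⟨x, rfl⟩ := toLe_surjective _ x
    obtain ⟨y, rfl⟩ := toLe_surjective _ y
    exact (toLe l).map_lie x y

theorem proj_toLe (l : ℕ) (x : GradedLie) : proj l (toLe (l + 1) x) = toLe l x := rfl

end GradedLie

/-! ## The Baker-Campbell-Hausdorff product -/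

namespace BCH

/-- The nested bracket `[x₁, [x₂, … [x_{k-1}, x_k] … ]]`. -/
def nested {L : Type*} [LieRing L] : List L → L
  | [] => 0
  | [x] => x
  | x :: y :: t => ⁅x, nested (y :: t)⁆

/-- The word `X^{r₁} Y^{s₁} ⋯ X^{r_k} Y^{s_k}`, where `p i = (r_i, s_i)`. -/
def word {L : Type*} {k : ℕ} (p : Fin k → ℕ × ℕ) (X Y : L) : List L :=
  (List.ofFn fun i => List.replicate (p i).1 X ++ List.replicate (p i).2 Y).flatten

/-- The tuples `((r₁, s₁), …, (r_k, s_k))` with all `r_i + s_i > 0` and `∑ (r_i + s_i) = d`. -/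
def blocks (d k : ℕ) : Finset (Fin k → ℕ × ℕ) :=
  (Fintype.piFinset fun _ => Finset.range (d + 1) ×ˢ Finset.range (d + 1)).filter
    fun p => (∀ i, 0 < (p i).1 + (p i).2) ∧ ∑ i, ((p i).1 + (p i).2) = d

/-- The component of degree `d` of the Baker-Campbell-Hausdorff series (Dynkin's formula). -/
def term {L : Type*} [LieRing L] [LieAlgebra ℚ L] (d : ℕ) (X Y : L) : L :=
  ∑ k ∈ Finset.Icc 1 d, ∑ p ∈ blocks d k,
    ((-1 : ℚ) ^ (k - 1) / k *
      (1 / (d * ∏ i, ((Nat.factorial (p i).1 : ℚ) * (Nat.factorial (p i).2 : ℚ))))) •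
      nested (word p X Y)

/-- The Baker-Campbell-Hausdorff series up to degree `l`. It is the whole series in a Lie algebra
in which all nested brackets of more than `l` elements vanish. -/
def bch {L : Type*} [LieRing L] [LieAlgebra ℚ L] (l : ℕ) (X Y : L) : L :=
  ∑ d ∈ Finset.Icc 1 l, term d X Y

section

variable {L L' : Type*} [LieRing L] [LieAlgebra ℚ L] [LieRing L'] [LieAlgebra ℚ L']

theorem map_nested (f : L →ₗ⁅ℚ⁆ L') (w : List L) : f (nested w) = nested (w.map f) := by
  induction w with
  | nil => exact map_zero f
  | cons x t ih =>
    cases t with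
    | nil => rfl
    | cons y t => simp only [nested, LieHom.map_lie, ih, List.map_cons]

theorem map_word {L L' : Type*} {k : ℕ} (f : L → L') (p : Fin k → ℕ × ℕ) (X Y : L) :
    (word p X Y).map f = word p (f X) (f Y) := by
  simp [word, List.map_flatten, List.map_ofFn, Function.comp_def]

theorem length_word {L : Type*} {k : ℕ} (p : Fin k → ℕ × ℕ) (X Y : L) :
    (word p X Y).length = ∑ i, ((p i).1 + (p i).2) := by
  simp [word, List.length_flatten, List.map_ofFn, Function.comp_def, List.sum_ofFn]

theorem map_term (f : L →ₗ⁅ℚ⁆ L') (d : ℕ) (X Y : L) : f (term d X Y) = term d (f X) (f Y) := by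
  simp only [term, map_sum, map_smul, map_nested, map_word]

theorem map_bch (f : L →ₗ⁅ℚ⁆ L') (l : ℕ) (X Y : L) : f (bch l X Y) = bch l (f X) (f Y) := by
  simp only [bch, map_sum, map_term]

theorem nested_eq_zero {L : Type*} [LieRing L] (X : L) (w : List L) (hw : ∀ x ∈ w, x = 0 ∨ x = X) (h : 2 ≤ w.length) :
    nested w = 0 := by
  induction w with
  | nil => rfl
  | cons x t ih =>
    cases t with
    | nil => simp at h
    | cons y t =>
      cases t with
      | nil =>
        simp only [nested]
        rcases hw x (by simp) with rfl | rfl <;> rcases hw y (by simp) with rfl | rfl <;> simp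
      | cons z t =>
        rw [nested, ih (fun x hx => hw x (List.mem_cons_of_mem _ hx)) (by simp), lie_zero]

theorem mem_word {L : Type*} {k : ℕ} (p : Fin k → ℕ × ℕ) (X Y x : L) (hx : x ∈ word p X Y) :
    x = X ∨ x = Y := by
  simp only [word, List.mem_flatten, List.mem_ofFn] at hx
  obtain ⟨_, ⟨i, rfl⟩, hx⟩ := hx
  simp only [List.mem_append, List.mem_replicate] at hx
  tauto

theorem blocks_one_one : blocks 1 1 = {fun _ => (1, 0), fun _ => (0, 1)} := by
  decide

theorem term_one (X Y : L) : term 1 X Y = X + Y := by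
  rw [term, show Finset.Icc 1 1 = {1} from rfl, Finset.sum_singleton, blocks_one_one,
    Finset.sum_pair (by decide)]
  simp [word, nested]

theorem bch_zero_left {l : ℕ} (hl : 1 ≤ l) (X : L) : bch l 0 X = X := by
  rw [bch, Finset.sum_eq_single_of_mem 1 (by simp [hl]), term_one, zero_add]
  intro d hd hd1
  refine Finset.sum_eq_zero fun k _ => Finset.sum_eq_zero fun p hp => ?_
  rw [nested_eq_zero X _ (mem_word p 0 X), smul_zero]
  rw [length_word, (Finset.mem_filter.1 hp).2.2]
  simp only [Finset.mem_Icc] at hd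
  omega

end

end BCH

namespace GradedLie

theorem nested_mem (w : List GradedLie) (hw : w ≠ []) :
    BCH.nested w ∈ gtSubmodule (w.length - 1) := by
  induction w with
  | nil => exact absurd rfl hw
  | cons x t ih =>
    cases t with
    | nil => rw [show [x].length - 1 = 0 from rfl, gtSubmodule_zero]; trivial
    | cons y t => exact lie_mem_gtSubmodule x (ih (by simp))

theorem bch_succ (l : ℕ) (x y : Le l) : BCH.bch (l + 1) x y = BCH.bch l x y := by
  obtain ⟨x, rfl⟩ := toLe_surjective _ x
  obtain ⟨y, rfl⟩ := toLe_surjective _ y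
  rw [BCH.bch, Finset.sum_Icc_succ_top (by omega)]
  refine add_eq_left.2 (Finset.sum_eq_zero fun k _ => Finset.sum_eq_zero fun p hp => ?_)
  have hlen := BCH.length_word p x y
  rw [(Finset.mem_filter.1 hp).2.2] at hlen
  have h := nested_mem (BCH.word p x y) (List.ne_nil_of_length_pos (by omega))
  rw [hlen, Nat.add_sub_cancel] at h
  rw [← BCH.map_word, ← BCH.map_nested, toLe_eq_zero.2 h, smul_zero]

end GradedLie

/-! ## The structure group -/

/-- The group `G^{≤ l} = {exp(X) : X ∈ 𝔤^{≤ l}}`. -/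
@[ext]
structure GroupLe (l : ℕ) where
  exp ::
  log : GradedLie.Le l

namespace GroupLe

noncomputable instance (l : ℕ) : Mul (GroupLe l) := ⟨fun g h => exp (BCH.bch l g.log h.log)⟩
noncomputable instance (l : ℕ) : One (GroupLe l) := ⟨exp 0⟩

/-- `exp(X) ^ c = exp(c X)`. -/
noncomputable instance (l : ℕ) : Pow (GroupLe l) ℚ := ⟨fun g c => exp (c • g.log)⟩

/-- The canonical projection `G^{≤ l+1} → G^{≤ l}`. -/
noncomputable def proj {l : ℕ} (g : GroupLe (l + 1)) : GroupLe l := exp (GradedLie.proj l g.log)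

theorem proj_mul {l : ℕ} (g h : GroupLe (l + 1)) : proj (g * h) = proj g * proj h := by
  refine GroupLe.ext ?_
  show GradedLie.proj l (BCH.bch (l + 1) g.log h.log) = BCH.bch l _ _
  rw [BCH.map_bch, GradedLie.bch_succ]
  rfl

theorem proj_one {l : ℕ} : proj (1 : GroupLe (l + 1)) = 1 :=
  GroupLe.ext (map_zero (GradedLie.proj l))

theorem proj_pow {l : ℕ} (g : GroupLe (l + 1)) (c : ℚ) : proj (g ^ c) = proj g ^ c :=
  GroupLe.ext (map_smul (GradedLie.proj l) c g.log)

theorem one_pow {l : ℕ} (c : ℚ) : (1 : GroupLe l) ^ c = 1 :=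
  GroupLe.ext (smul_zero c)

theorem one_mul {l : ℕ} (g : GroupLe l) : 1 * g = g := by
  refine GroupLe.ext ?_
  rcases Nat.eq_zero_or_pos l with rfl | hl
  · obtain ⟨x, hx⟩ := GradedLie.toLe_surjective _ (1 * g : GroupLe 0).log
    obtain ⟨y, hy⟩ := GradedLie.toLe_surjective _ g.log
    have h : ∀ x, GradedLie.toLe 0 x = 0 := fun x => by
      rw [GradedLie.toLe_eq_zero, GradedLie.gtSubmodule_zero]; trivial
    rw [← hx, ← hy, h, h]
  · exact BCH.bch_zero_left hl g.log

end GroupLe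

/-- The structure group `G = lim G^{≤ l}`. -/
@[ext]
structure StructureGroup where
  /-- The projection `π_l : G → G^{≤ l}`. -/
  π : ∀ l, GroupLe l
  compat : ∀ l, (π (l + 1)).proj = π l

namespace StructureGroup

noncomputable instance : Mul StructureGroup :=
  ⟨fun g h => ⟨fun l => g.π l * h.π l, fun l => by rw [GroupLe.proj_mul, g.compat, h.compat]⟩⟩

noncomputable instance : One StructureGroup := ⟨⟨fun _ => 1, fun _ => GroupLe.proj_one⟩⟩

noncomputable instance : Pow StructureGroup ℚ :=
  ⟨fun g c => ⟨fun l => g.π l ^ c, fun l => by rw [GroupLe.proj_pow, g.compat]⟩⟩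

/-- The dilogarithm element `Ψ[n] = exp(∑_{j ≥ 1} (-1)^{j+1} / j² X_{jn})`. Its image in `G^{≤ l}`
only involves the terms with `j ≤ l`, as `deg (jn) ≥ j`; the index below is `i = j - 1`. -/
noncomputable def Ψ (n : NPlus) : StructureGroup where
  π l := GroupLe.exp (GradedLie.toLe l
    (∑ i ∈ Finset.range l, ((-1 : ℚ) ^ (i + 2) / ((i : ℚ) + 1) ^ 2) •
      GradedLie.X (NPlus.succMul i n)))
  compat l := by
    refine GroupLe.ext ?_
    show GradedLie.proj l (GradedLie.toLe (l + 1) _) = _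
    rw [GradedLie.proj_toLe, Finset.sum_range_succ, map_add, add_eq_left, map_smul,
      GradedLie.toLe_eq_zero.2 (GradedLie.X_mem_gtSubmodule (NPlus.lt_deg_succMul l n)), smul_zero]

theorem π_Ψ_eq_one {l : ℕ} {n : NPlus} (h : l < n.deg) : (Ψ n).π l = 1 := by
  refine GroupLe.ext ?_
  show GradedLie.toLe l _ = 0
  rw [map_sum]
  refine Finset.sum_eq_zero fun i _ => ?_
  rw [map_smul, GradedLie.toLe_eq_zero.2 (GradedLie.X_mem_gtSubmodule (h.trans_le ?_)), smul_zero]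
  show n.a + n.b ≤ (i + 1) * n.a + (i + 1) * n.b
  nlinarith

/-- The ordered product of the `Ψ[n] ^ (u n)` over all `n ∈ N⁺`, in increasing order of `n` from
left to right. Its image in `G^{≤ l}` is the finite product over `deg n ≤ l`, as all other factors
are trivial there. -/
noncomputable def orderedProd (u : NPlus → ℚ) : StructureGroup where
  π l := (((NPlus.degLE l).sort (· ≤ ·)).map fun n => (Ψ n).π l ^ u n).prod
  compat l := by
    have hfilter : (NPlus.degLE l).sort (· ≤ ·) =
        ((NPlus.degLE (l + 1)).sort (· ≤ ·)).filter (fun n => n.deg ≤ l) := by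
      refine List.Perm.eq_of_pairwise (le := (· ≤ ·)) (fun _ _ _ _ h h' => le_antisymm h h')
        (Finset.pairwise_sort _ _) ((Finset.pairwise_sort _ _).filter _) ?_
      refine (List.perm_ext_iff_of_nodup (Finset.sort_nodup _ _)
        ((Finset.sort_nodup _ _).filter _)).2 fun n => ?_
      simp only [Finset.mem_sort, List.mem_filter, NPlus.mem_degLE, decide_eq_true_eq]
      omega
    rw [hfilter]
    induction (NPlus.degLE (l + 1)).sort (· ≤ ·) with
    | nil => exact GroupLe.proj_one
    | cons n t ih =>
      rw [List.map_cons, List.prod_cons, GroupLe.proj_mul, ih, GroupLe.proj_pow, (Ψ n).compat]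
      by_cases hn : n.deg ≤ l
      · rw [List.filter_cons_of_pos (by simpa using hn), List.map_cons, List.prod_cons]
      · rw [List.filter_cons_of_neg (by simpa using hn), π_Ψ_eq_one (not_le.1 hn),
          GroupLe.one_pow, GroupLe.one_mul]

/-- The family `u` consists of the exponents of the ordered product of
`Ψ[(0,1)]^n Ψ[(1,0)]^m`. -/
def IsOrderedExponents (m n : ℕ) (u : NPlus → ℚ) : Prop :=
  Ψ ⟨0, 1, by norm_num⟩ ^ (n : ℚ) * Ψ ⟨1, 0, by norm_num⟩ ^ (m : ℚ) = orderedProd u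

end StructureGroup

/-!
Call `b` the *level* of `(a, b)`. The proof has two independent halves.

**Existence and uniqueness of the exponents.** The kernel of `G^{≤ l+1} → G^{≤ l}` is central and
spanned by the images of the `X_p` with `deg p = l + 1`. Changing the exponents in degree `l + 1` only
therefore multiplies an ordered product by an element of that kernel, and each element of the kernel
arises from exactly one change (`StructureGroup.log_π_orderedProd_succ`); the claim follows by
induction on `l`. This uses nothing about the Baker-Campbell-Hausdorff series except that its linear
part is `X + Y` and its other terms are brackets (`BCH.bch_add_central`).

**The formula.** The Lie algebra `𝔤` acts on polynomials in two variables by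
`X_p · x^q = {p, q} x^(p+q)`, and the action survives modulo `x^(N+1)` and `y^3`, where all
operators are nilpotent (`PoissonRep.rep`). To exponentiate it to the group one needs the
Baker-Campbell-Hausdorff theorem in Dynkin's form, `BCH.exp_mul_exp_eq_exp_bch`. Let
`exp Z = exp (tX) * exp (tY)` over polynomials in `t`, and let `D` be the Euler derivation
`t d/dt`, so that `[D, tX] = tX` and `[D, tY] = tY`. Computing `exp Z * D * exp (-Z)` in two ways
gives `(exp (ad Z) - 1) / (ad Z) · [D, Z] = tX + exp (ad tX) (tY)`. As
`exp (ad Z) = exp (ad tX) exp (ad tY) =: 1 + E`, the inverse of the operator on the left is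
`log (1 + E) / E`, and expanding it in powers of `E` yields Dynkin's formula for `[D, Z]`
(`BCH.lie_euler`, `BCH.aeval_logDiv_apply_eq_sum_term`).

In the ordered product the factors of level zero come first. They commute, and comparing level-zero
parts shows that their product is `Ψ[(1,0)]^m`. Cancelling it leaves, on the other side, the conjugate
of `Ψ[(0,1)]^n` by `Ψ[(1,0)]^m`. Identify the part of level `b` with the polynomials in `x`, letting
`X_(k,b)` correspond to `x^k`. There `[log Ψ[(1,0)], ·]` is multiplication by `-b log (1 + x)`, so
this conjugation multiplies level `b` by `(1 + x)^(b m)` (`PoissonRep.rep_conjPsi`).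
Operators of positive level are two-step nilpotent modulo `y^3`, so the remaining factors combine into
a single exponential whose logarithm is the sum of the logarithms plus half the sum of the brackets of
ordered pairs (`PoissonRep.prod_exp_rep`). Level one then gives `u_(k,1) = n * choose m k`, and
level two gives `u_(a,2)` in terms of `∑ |a - 2 i| choose m i * choose m (a - i)` and
`choose (2 m) a` (`StructureGroup.exponent_level_two`).

It remains to expand in the basis `choose m k`. This rests on
`choose m i * choose m (a - i) = ∑ k, choose m k * choose k i * choose i (a - k)` and on the
telescoping sum `∑_{s < h} (d - 2 s) choose d s = h * choose d h`, applied to `d = 2 k - a`.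
-/

/-! ### Truncated exponential and logarithm polynomials -/

namespace NilpotentExpLog

open Polynomial Finset

/-- The truncated exponential series `∑_{i < N} Xⁱ / i!`. -/
noncomputable def expPoly (N : ℕ) : ℚ[X] := ∑ i ∈ range N, C ((i.factorial : ℚ)⁻¹) * X ^ i

/-- The truncation of `(exp X - 1) / X`. -/
noncomputable def expDiv (N : ℕ) : ℚ[X] := ∑ i ∈ range N, C (((i + 1).factorial : ℚ)⁻¹) * X ^ i

/-- The truncation of `log (1 + X) / X`. -/
noncomputable def logDiv (N : ℕ) : ℚ[X] := ∑ i ∈ range N, C ((-1 : ℚ) ^ i / (i + 1)) * X ^ i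

/-- The truncation of `log (1 + X)` at degree `N` (inclusive). -/
noncomputable def logPoly (N : ℕ) : ℚ[X] := X * logDiv N

theorem expPoly_succ (N : ℕ) :
    expPoly (N + 1) = expPoly N + C ((N.factorial : ℚ)⁻¹) * X ^ N := by
  rw [expPoly, sum_range_succ, expPoly]

theorem expPoly_succ_eq (N : ℕ) : expPoly (N + 1) = 1 + X * expDiv N := by
  rw [expPoly, sum_range_succ', expDiv, mul_sum, add_comm]
  simp only [Nat.factorial_zero, Nat.cast_one, inv_one, map_one, pow_zero, mul_one]
  congr 1
  exact sum_congr rfl fun i _ => by ring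

theorem derivative_expPoly_succ (N : ℕ) : derivative (expPoly (N + 1)) = expPoly N := by
  rw [expPoly, derivative_sum, sum_range_succ']
  simp only [derivative_C_mul_X_pow, pow_zero, mul_one, derivative_C, add_zero, expPoly]
  refine sum_congr rfl fun i _ => ?_
  congr 2
  rw [Nat.factorial_succ]
  push_cast
  field_simp

theorem one_add_X_mul_derivative_logPoly (N : ℕ) :
    (1 + X) * derivative (logPoly N) = 1 - (-X : ℚ[X]) ^ N := by
  have h : derivative (logPoly N) = ∑ i ∈ range N, (-X : ℚ[X]) ^ i := by
    rw [logPoly, logDiv, mul_sum, derivative_sum]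
    refine sum_congr rfl fun i _ => ?_
    rw [show (X : ℚ[X]) * (C ((-1 : ℚ) ^ i / (i + 1)) * X ^ i) =
      C ((-1 : ℚ) ^ i / (i + 1)) * X ^ (i + 1) by ring, derivative_C_mul_X_pow, Nat.add_sub_cancel,
      neg_pow (X : ℚ[X]) i]
    congr 1
    rw [show (-1 : ℚ[X]) ^ i = C ((-1) ^ i) by simp]
    congr 1
    push_cast
    field_simp
  have h2 := geom_sum_mul (-X : ℚ[X]) N
  rw [h]
  linear_combination -h2

/-- If `F` satisfies the differential equation of `(1 + X) ^ c` up to order `N` and has no constant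
term, it vanishes up to order `N + 1`. -/
theorem X_pow_dvd_of_ode {F : ℚ[X]} (c : ℚ) (N : ℕ) (h0 : F.coeff 0 = 0)
    (h : X ^ N ∣ (1 + X) * derivative F - C c * F) : X ^ (N + 1) ∣ F := by
  rw [X_pow_dvd_iff] at h ⊢
  intro d hd
  induction d with
  | zero => exact h0
  | succ d ih =>
    have h1 := h d (by omega)
    have h2 := ih (by omega)
    have h3 : (X * derivative F).coeff d = d * F.coeff d := by
      cases d with
      | zero => simp
      | succ d => rw [coeff_X_mul, coeff_derivative]; push_cast; ring
    rw [add_mul, one_mul, coeff_sub, coeff_add, h3, coeff_derivative, coeff_C_mul, h2] at h1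
    have h4 : ((d : ℚ) + 1) ≠ 0 := by positivity
    have h5 : F.coeff (d + 1) * ((d : ℚ) + 1) = 0 := by linarith
    exact (mul_eq_zero.1 h5).resolve_right h4

theorem X_pow_dvd_of_derivative {F : ℚ[X]} (N : ℕ) (h0 : F.coeff 0 = 0)
    (h : X ^ N ∣ derivative F) : X ^ (N + 1) ∣ F :=
  X_pow_dvd_of_ode 0 N h0 (by simpa using h.mul_left _)

theorem coeff_zero_expPoly_comp (N : ℕ) {p : ℚ[X]} (hp : p.coeff 0 = 0) :
    ((expPoly (N + 1)).comp p).coeff 0 = 1 := by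
  rw [expPoly_succ_eq, coeff_zero_eq_eval_zero, eval_comp, ← coeff_zero_eq_eval_zero, hp]
  simp

theorem coeff_zero_logPoly (N : ℕ) : (logPoly N).coeff 0 = 0 := by simp [logPoly]

/-- `exp (c log (1 + X)) = (1 + X) ^ c` up to order `N`. -/
theorem X_pow_dvd_expPoly_comp_logPoly (c N : ℕ) :
    X ^ (N + 1) ∣ (expPoly (N + 1)).comp (C (c : ℚ) * logPoly N) - (1 + X) ^ c := by
  refine X_pow_dvd_of_ode c N ?_ ?_
  · rw [coeff_sub, coeff_zero_expPoly_comp]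
    · simp [coeff_zero_eq_eval_zero]
    · rw [coeff_C_mul, coeff_zero_logPoly, mul_zero]
  · have hc : (1 + X : ℚ[X]) * derivative ((1 + X) ^ c) = C (c : ℚ) * (1 + X) ^ c := by
      rw [derivative_pow]
      cases c with
      | zero => simp
      | succ c => simp only [Nat.add_sub_cancel, derivative_add, derivative_one, derivative_X]; ring
    have h1 : (1 + X : ℚ[X]) * derivative ((expPoly (N + 1)).comp (C (c : ℚ) * logPoly N)) =
        C (c : ℚ) * (1 - (-X) ^ N) * (expPoly N).comp (C (c : ℚ) * logPoly N) := by
      rw [derivative_comp, derivative_expPoly_succ, derivative_C_mul,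
        ← one_add_X_mul_derivative_logPoly]
      ring
    rw [derivative_sub, mul_sub, h1, hc, expPoly_succ, add_comp, mul_comp, C_comp, X_pow_comp,
      logPoly]
    refine ⟨C (c : ℚ) * (-(-1) ^ N * (expPoly N).comp (C (c : ℚ) * (X * logDiv N)) -
      C ((N.factorial : ℚ)⁻¹) * (C (c : ℚ) * logDiv N) ^ N), ?_⟩
    rw [neg_pow (X : ℚ[X]) N, mul_pow (C (c : ℚ)) (X * logDiv N), mul_pow X (logDiv N),
      mul_pow (C (c : ℚ))]
    ring

/-- `log (exp X) = X` up to order `N`. -/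
theorem X_pow_dvd_logPoly_comp_expPoly (N : ℕ) :
    X ^ (N + 1) ∣ (logPoly N).comp (expPoly (N + 1) - 1) - X := by
  refine X_pow_dvd_of_derivative N ?_ ?_
  · rw [logPoly, expPoly_succ_eq]
    simp [coeff_zero_eq_eval_zero]
  · have hE : expPoly (N + 1) = 1 + X * expDiv N := expPoly_succ_eq N
    have h1 : expPoly (N + 1) * derivative ((logPoly N).comp (expPoly (N + 1) - 1)) =
        (1 - (-(X * expDiv N)) ^ N) * expPoly N := by
      have h2 := congrArg (fun p : ℚ[X] => p.comp (X * expDiv N))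
        (one_add_X_mul_derivative_logPoly N)
      simp only [mul_comp, add_comp, one_comp, X_comp, sub_comp, pow_comp, neg_comp] at h2
      rw [derivative_comp, derivative_sub, derivative_one, sub_zero, derivative_expPoly_succ]
      rw [hE, add_sub_cancel_left, ← h2]
      ring
    have h3 : X ^ N ∣ expPoly (N + 1) *
        derivative ((logPoly N).comp (expPoly (N + 1) - 1) - X) := by
      rw [derivative_sub, derivative_X, mul_sub, h1]
      refine ⟨-(-1) ^ N * expDiv N ^ N * expPoly N - C ((N.factorial : ℚ)⁻¹), ?_⟩
      rw [expPoly_succ, neg_pow (X * expDiv N), mul_pow]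
      ring
    refine (IsCoprime.pow_left ?_).dvd_of_dvd_mul_left h3
    exact ⟨-expDiv N, 1, by rw [hE]; ring⟩

theorem X_pow_dvd_logDiv_mul_expDiv (N : ℕ) :
    X ^ N ∣ (logDiv N).comp (expPoly (N + 1) - 1) * expDiv N - 1 := by
  have h := X_pow_dvd_logPoly_comp_expPoly N
  rw [logPoly, mul_comp, X_comp] at h
  nth_rewrite 1 [expPoly_succ_eq] at h
  rw [add_sub_cancel_left, pow_succ', show X * expDiv N * (logDiv N).comp (expPoly (N + 1) - 1) - X =
    X * ((logDiv N).comp (expPoly (N + 1) - 1) * expDiv N - 1) by ring] at h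
  exact (mul_dvd_mul_iff_left X_ne_zero).1 h

/-! ### Exponential and logarithm of nilpotent elements -/

section Nilpotent

attribute [local instance] LieRing.ofAssociativeRing

variable {A : Type*} [Ring A] [Algebra ℚ A]

theorem aeval_eq_of_dvd {a : A} {N : ℕ} (ha : a ^ N = 0) {p q : ℚ[X]} (h : X ^ N ∣ p - q) :
    aeval a p = aeval a q := by
  obtain ⟨r, hr⟩ := h
  rw [← sub_eq_zero, ← map_sub, hr, map_mul, map_pow, aeval_X, ha, zero_mul]

theorem exp_eq_aeval {a : A} {N : ℕ} (ha : a ^ N = 0) :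
    IsNilpotent.exp a = aeval a (expPoly N) := by
  rw [IsNilpotent.exp_eq_sum ha, expPoly, map_sum]
  refine sum_congr rfl fun i _ => ?_
  rw [map_mul, aeval_C, map_pow, aeval_X, Algebra.smul_def]

theorem aeval_logPoly_pow {a : A} {N M : ℕ} (ha : a ^ N = 0) : (aeval a (logPoly M)) ^ N = 0 := by
  rw [← map_pow, logPoly, mul_pow, map_mul, map_pow, aeval_X, ha, zero_mul]

theorem exp_smul_log {a : A} {N : ℕ} (ha : a ^ N = 0) (c : ℕ) :
    IsNilpotent.exp ((c : ℚ) • aeval a (logPoly N)) = (1 + a) ^ c := by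
  have ha' : a ^ (N + 1) = 0 := by rw [pow_succ, ha, zero_mul]
  have h1 : ((c : ℚ) • aeval a (logPoly N)) ^ (N + 1) = 0 := by
    rw [_root_.smul_pow, aeval_logPoly_pow ha', smul_zero]
  rw [exp_eq_aeval h1, Algebra.smul_def, ← aeval_C (R := ℚ) a, ← map_mul, ← aeval_comp,
    aeval_eq_of_dvd ha' (X_pow_dvd_expPoly_comp_logPoly c N)]
  simp

theorem exp_log {a : A} {N : ℕ} (ha : a ^ N = 0) :
    IsNilpotent.exp (aeval a (logPoly N)) = 1 + a := by
  simpa using exp_smul_log ha 1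

theorem log_exp {a : A} {N : ℕ} (ha : a ^ N = 0) :
    aeval (IsNilpotent.exp a - 1) (logPoly N) = a := by
  have ha' : a ^ (N + 1) = 0 := by rw [pow_succ, ha, zero_mul]
  have h := aeval_eq_of_dvd ha' (X_pow_dvd_logPoly_comp_expPoly N)
  rwa [aeval_comp, map_sub, map_one, aeval_X, ← exp_eq_aeval ha'] at h

theorem exp_injective {a b : A} (ha : IsNilpotent a) (hb : IsNilpotent b)
    (h : IsNilpotent.exp a = IsNilpotent.exp b) : a = b := by
  obtain ⟨n, hn⟩ := ha
  obtain ⟨k, hk⟩ := hb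
  rw [← log_exp (pow_eq_zero_of_le (le_max_left n k) hn),
    ← log_exp (pow_eq_zero_of_le (le_max_right n k) hk), h]

theorem logDiv_mul_expDiv {a : A} {N : ℕ} (ha : a ^ N = 0) :
    aeval (IsNilpotent.exp a - 1) (logDiv N) * aeval a (expDiv N) = 1 := by
  have ha' : a ^ (N + 1) = 0 := by rw [pow_succ, ha, zero_mul]
  have h := aeval_eq_of_dvd ha (X_pow_dvd_logDiv_mul_expDiv N)
  rwa [map_mul, aeval_comp, map_sub, map_one, ← exp_eq_aeval ha'] at h

theorem exp_eq_one_add {a : A} {N : ℕ} (ha : a ^ N = 0) :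
    IsNilpotent.exp a = 1 + aeval a (expDiv N) * a := by
  have ha' : a ^ (N + 1) = 0 := by rw [pow_succ, ha, zero_mul]
  rw [exp_eq_aeval ha', expPoly_succ_eq, mul_comm X]
  simp

/-- Conjugation by `exp z` is the exponential of `ad z`. -/
theorem exp_ad_apply {z : A} (hz : IsNilpotent z) (b : A) :
    IsNilpotent.exp (LieAlgebra.ad ℚ A z) b = IsNilpotent.exp z * b * IsNilpotent.exp (-z) := by
  have hl : IsNilpotent (LinearMap.mulLeft ℚ z) := by simpa using hz
  have key : ∀ z : A, IsNilpotent z →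
      IsNilpotent.exp (LinearMap.mulRight ℚ z) b = b * IsNilpotent.exp z := by
    rintro z ⟨n, hn⟩
    have h : (LinearMap.mulRight ℚ z) ^ n = 0 := by
      rw [LinearMap.pow_mulRight, hn, LinearMap.mulRight_zero_eq_zero]
    rw [IsNilpotent.exp_eq_sum hn, IsNilpotent.exp_eq_sum h, LinearMap.sum_apply, mul_sum]
    refine sum_congr rfl fun i _ => ?_
    rw [LinearMap.smul_apply, LinearMap.pow_mulRight, LinearMap.mulRight_apply, mul_smul_comm]
  have h1 : LieAlgebra.ad ℚ A z = LinearMap.mulLeft ℚ z + LinearMap.mulRight ℚ (-z) := by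
    ext x
    simp [LieRing.of_associative_ring_bracket, sub_eq_add_neg]
  have h2 : IsNilpotent.exp (LinearMap.mulLeft ℚ z) =
      LinearMap.mulLeft ℚ (IsNilpotent.exp z) :=
    (IsNilpotent.map_exp hz (Algebra.lmul ℚ A)).symm
  rw [h1, IsNilpotent.exp_add_of_commute (LinearMap.commute_mulLeft_right _ _) hl
    (by simpa using hz.neg), Module.End.mul_apply, key _ hz.neg, h2, LinearMap.mulLeft_apply,
    mul_assoc]

end Nilpotent

end NilpotentExpLog

/-! ### Dynkin's formula for an Euler derivation -/

namespace BCH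

open Polynomial Finset NilpotentExpLog

theorem nested_cons {L : Type*} [LieRing L] (x : L) {t : List L} (ht : t ≠ []) :
    nested (x :: t) = ⁅x, nested t⁆ := by
  cases t with
  | nil => exact absurd rfl ht
  | cons y t => rfl

theorem nested_replicate_append {L : Type*} [LieRing L] [LieAlgebra ℚ L] (x : L) (r : ℕ)
    {t : List L} (ht : t ≠ []) :
    nested (List.replicate r x ++ t) = ((LieAlgebra.ad ℚ L x) ^ r) (nested t) := by
  induction r with
  | zero => rfl
  | succ r ih =>
    rw [List.replicate_succ, List.cons_append, nested_cons x (by simp [ht]), ih, pow_succ',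
      Module.End.mul_apply, LieAlgebra.ad_apply]

theorem word_succ {L : Type*} {k : ℕ} (p : Fin (k + 1) → ℕ × ℕ) (X Y : L) :
    word p X Y = List.replicate (p 0).1 X ++ (List.replicate (p 0).2 Y ++
      word (fun i => p i.succ) X Y) := by
  simp [word, List.ofFn_succ]

/-- The exponents `(r, s) ≠ (0, 0)` with `r, s < K`. -/
def block (K : ℕ) : Finset (ℕ × ℕ) := (range K ×ˢ range K).filter fun j => 0 < j.1 + j.2

/-- The coefficient `1 / (r! s!)` of `X ^ r Y ^ s` in `exp X * exp Y`. -/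
def blockCoeff (j : ℕ × ℕ) : ℚ := ((Nat.factorial j.1 : ℚ) * (Nat.factorial j.2 : ℚ))⁻¹

theorem word_ne_nil {L : Type*} {k K : ℕ} {p : Fin (k + 1) → ℕ × ℕ}
    (hp : p ∈ Fintype.piFinset fun _ => block K) (X Y : L) : word p X Y ≠ [] := by
  have h := (mem_filter.1 (Fintype.mem_piFinset.1 hp 0)).2
  rw [word_succ]
  intro h0
  simp only [List.append_eq_nil_iff, List.replicate_eq_nil_iff] at h0
  omega

section Lie

variable {L : Type*} [LieRing L] [LieAlgebra ℚ L]

theorem exp_ad_mul_exp_ad_sub_one {X Y : L} {K : ℕ} (hK : 0 < K)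
    (hX : (LieAlgebra.ad ℚ L X) ^ K = 0) (hY : (LieAlgebra.ad ℚ L Y) ^ K = 0) :
    IsNilpotent.exp (LieAlgebra.ad ℚ L X) * IsNilpotent.exp (LieAlgebra.ad ℚ L Y) - 1 =
      ∑ j ∈ block K, blockCoeff j • ((LieAlgebra.ad ℚ L X) ^ j.1 * (LieAlgebra.ad ℚ L Y) ^ j.2) := by
  rw [IsNilpotent.exp_eq_sum hX, IsNilpotent.exp_eq_sum hY, sum_mul_sum, ← sum_product', block,
    sum_filter, sub_eq_iff_eq_add]
  rw [← Finset.sum_ite_eq_of_mem' (range K ×ˢ range K) ((0, 0) : ℕ × ℕ)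
    (fun _ => (1 : Module.End ℚ L)) (by simpa using hK), ← sum_add_distrib]
  refine sum_congr rfl fun j _ => ?_
  rcases j with ⟨r, s⟩
  by_cases h : 0 < r + s
  · rw [if_pos h, if_neg (by rw [Prod.mk.injEq]; omega), add_zero, smul_mul_smul_comm, blockCoeff,
      mul_inv]
  · obtain ⟨rfl, rfl⟩ : r = 0 ∧ s = 0 := by omega
    simp

/-- The element `X + exp (ad X) Y` collects the nested brackets of all words of a single block
`Xʳ Yˢ`: those with at least two trailing equal letters vanish. -/
theorem add_exp_ad_apply {X Y : L} {K : ℕ} (hX : (LieAlgebra.ad ℚ L X) ^ (K + 2) = 0) :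
    X + IsNilpotent.exp (LieAlgebra.ad ℚ L X) Y =
      ∑ j ∈ block (K + 2), blockCoeff j •
        nested (List.replicate j.1 X ++ List.replicate j.2 Y) := by
  have h0 : ∀ j ∈ range (K + 2) ×ˢ range (K + 2), blockCoeff j •
      nested (List.replicate j.1 X ++ List.replicate j.2 Y) ≠ 0 → 0 < j.1 + j.2 := by
    rintro ⟨r, s⟩ - h
    by_contra h1
    obtain ⟨rfl, rfl⟩ : r = 0 ∧ s = 0 := by simp only at h1; omega
    exact h (smul_zero _)
  have h2 : ∀ r s, nested (List.replicate r X ++ List.replicate (s + 2) Y) = 0 := fun r s => by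
    rw [nested_replicate_append X r (by simp), nested_eq_zero Y, map_zero]
    · intro x hx; exact Or.inr (List.eq_of_mem_replicate hx)
    · simp
  have h3 : ∀ r, nested (List.replicate r X ++ List.replicate 0 Y) = if r = 1 then X else 0 := by
    intro r
    rw [List.replicate_zero, List.append_nil]
    rcases r with _ | _ | r
    · rfl
    · rfl
    · rw [if_neg (by omega), nested_eq_zero X]
      · intro x hx; exact Or.inr (List.eq_of_mem_replicate hx)
      · simp
  have h4 : ∀ r, nested (List.replicate r X ++ List.replicate (0 + 1) Y) =
      ((LieAlgebra.ad ℚ L X) ^ r) Y := fun r => nested_replicate_append X r (by simp)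
  rw [block, sum_filter_of_ne h0, sum_product]
  have h5 : ∀ r, ∑ s ∈ range (K + 2), blockCoeff (r, s) •
      nested (List.replicate r X ++ List.replicate s Y) =
      blockCoeff (r, 0 + 1) • ((LieAlgebra.ad ℚ L X) ^ r) Y +
        blockCoeff (r, 0) • (if r = 1 then X else 0) := by
    intro r
    rw [sum_range_succ', sum_range_succ']
    simp only [h2, h3, h4, smul_zero, sum_const_zero, zero_add]
  rw [sum_congr rfl fun r _ => h5 r, sum_add_distrib, add_comm,
    IsNilpotent.exp_eq_sum hX, LinearMap.sum_apply]
  congr 1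
  · refine sum_congr rfl fun r _ => ?_
    simp [blockCoeff]
  · simp_rw [smul_ite, smul_zero]
    rw [sum_ite_eq' _ 1, if_pos (by simp)]
    simp [blockCoeff]

theorem sum_piFinset_succ {M : Type*} [AddCommMonoid M] {k : ℕ} (s : Finset (ℕ × ℕ))
    (f : (Fin (k + 1) → ℕ × ℕ) → M) :
    ∑ p ∈ Fintype.piFinset (fun _ => s), f p =
      ∑ j ∈ s, ∑ p ∈ Fintype.piFinset (fun _ : Fin k => s), f (Fin.cons j p) := by
  rw [← sum_product']
  refine sum_nbij' (fun p => (p 0, fun i => p i.succ)) (fun x => Fin.cons x.1 x.2) ?_ ?_ ?_ ?_ ?_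
  · intro p hp
    rw [Fintype.mem_piFinset] at hp
    exact mem_product.2 ⟨hp 0, Fintype.mem_piFinset.2 fun i => hp _⟩
  · rintro ⟨j, p⟩ h
    obtain ⟨h1, h2⟩ := mem_product.1 h
    rw [Fintype.mem_piFinset] at h2 ⊢
    intro i
    cases i using Fin.cases with
    | zero => exact h1
    | succ i => exact h2 i
  · intro p _; exact Fin.cons_self_tail p
  · rintro ⟨j, p⟩ _; rfl
  · intro p _; exact congrArg f (Fin.cons_self_tail p).symm

/-- Each application of `exp (ad X) * exp (ad Y) - 1` puts one more nonempty block in front. -/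
theorem exp_ad_mul_exp_ad_sub_one_pow_apply {X Y : L} {K : ℕ}
    (hX : (LieAlgebra.ad ℚ L X) ^ (K + 2) = 0) (hY : (LieAlgebra.ad ℚ L Y) ^ (K + 2) = 0) (k : ℕ) :
    ((IsNilpotent.exp (LieAlgebra.ad ℚ L X) * IsNilpotent.exp (LieAlgebra.ad ℚ L Y) - 1) ^ k)
      (X + IsNilpotent.exp (LieAlgebra.ad ℚ L X) Y) =
    ∑ p ∈ Fintype.piFinset (fun _ : Fin (k + 1) => block (K + 2)),
      (∏ i, blockCoeff (p i)) • nested (word p X Y) := by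
  induction k with
  | zero =>
    rw [pow_zero, Module.End.one_apply, add_exp_ad_apply hX, sum_piFinset_succ]
    refine sum_congr rfl fun j _ => ?_
    simp [word]
  | succ k ih =>
    rw [pow_succ', Module.End.mul_apply, ih, exp_ad_mul_exp_ad_sub_one (by omega) hX hY,
      sum_piFinset_succ (k := k + 1), LinearMap.sum_apply]
    refine sum_congr rfl fun j _ => ?_
    rw [map_sum]
    refine sum_congr rfl fun p hp => ?_
    have hw : word (fun i => (Fin.cons j p : Fin (k + 2) → ℕ × ℕ) i.succ) X Y ≠ [] :=
      word_ne_nil hp X Y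
    rw [map_smul, Fin.prod_univ_succ (fun i => blockCoeff ((Fin.cons j p : Fin (k + 2) → ℕ × ℕ) i)),
      word_succ (Fin.cons j p), nested_replicate_append X _ (List.append_ne_nil_of_right_ne_nil _ hw),
      nested_replicate_append Y _ hw]
    simp only [Fin.cons_zero, Fin.cons_succ, LinearMap.smul_apply, Module.End.mul_apply]
    rw [smul_smul, mul_comm]

theorem blocks_eq_filter {d k K : ℕ} (hd : d < K) :
    blocks d k = (Fintype.piFinset (fun _ : Fin k => block K)).filter
      fun p => ∑ i, ((p i).1 + (p i).2) = d := by
  ext p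
  simp only [blocks, block, mem_filter, Fintype.mem_piFinset, mem_product, mem_range]
  constructor
  · rintro ⟨h1, h2, h3⟩
    refine ⟨fun i => ⟨?_, h2 i⟩, h3⟩
    have := h1 i
    omega
  · rintro ⟨h1, h3⟩
    refine ⟨fun i => ?_, fun i => (h1 i).2, h3⟩
    have : (p i).1 + (p i).2 ≤ d := h3 ▸ single_le_sum (f := fun i => (p i).1 + (p i).2)
      (fun _ _ => Nat.zero_le _) (mem_univ i)
    omega

theorem blocks_eq_empty {d k : ℕ} (h : d < k) : blocks d k = ∅ := by
  refine eq_empty_of_forall_notMem fun p hp => ?_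
  obtain ⟨-, h1, h2⟩ := mem_filter.1 hp
  have : ∑ _i : Fin k, 1 ≤ ∑ i, ((p i).1 + (p i).2) := sum_le_sum fun i _ => h1 i
  simp at this
  omega

/-- Dynkin's series, weighted by the degree, is `log (1 + E) / E` applied to `X + exp (ad X) Y`,
where `1 + E = exp (ad X) * exp (ad Y)`. -/
theorem aeval_logDiv_apply_eq_sum_term {X Y : L} {K l : ℕ} (hl : l < K + 2)
    (hX : (LieAlgebra.ad ℚ L X) ^ (K + 2) = 0) (hY : (LieAlgebra.ad ℚ L Y) ^ (K + 2) = 0)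
    (hw : ∀ (k : ℕ) (p : Fin k → ℕ × ℕ), l < (word p X Y).length → nested (word p X Y) = 0) :
    aeval (IsNilpotent.exp (LieAlgebra.ad ℚ L X) * IsNilpotent.exp (LieAlgebra.ad ℚ L Y) - 1)
        (logDiv (K + 2)) (X + IsNilpotent.exp (LieAlgebra.ad ℚ L X) Y) =
      ∑ d ∈ Icc 1 l, (d : ℚ) • term d X Y := by
  have h1 : ∀ k, ∑ p ∈ Fintype.piFinset (fun _ : Fin (k + 1) => block (K + 2)),
      (∏ i, blockCoeff (p i)) • nested (word p X Y) =
      ∑ d ∈ Icc 1 l, ∑ p ∈ blocks d (k + 1), (∏ i, blockCoeff (p i)) • nested (word p X Y) := by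
    intro k
    have h2 : ∀ d ∈ Icc 1 l, blocks d (k + 1) =
        ((Fintype.piFinset (fun _ : Fin (k + 1) => block (K + 2))).filter
          fun p => ∑ i, ((p i).1 + (p i).2) ∈ Icc 1 l).filter
          fun p => ∑ i, ((p i).1 + (p i).2) = d := by
      intro d hd
      rw [blocks_eq_filter (show d < K + 2 by rw [mem_Icc] at hd; omega), filter_filter]
      refine filter_congr fun p _ => ?_
      constructor
      · rintro rfl; exact ⟨hd, rfl⟩
      · exact fun h => h.2
    refine Eq.trans ?_ (sum_congr rfl fun d hd => (congrArg (fun s => ∑ p ∈ s,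
      (∏ i, blockCoeff (p i)) • nested (word p X Y)) (h2 d hd)).symm)
    rw [sum_fiberwise_of_maps_to (fun p hp => (mem_filter.1 hp).2), sum_filter_of_ne]
    intro p hp hne
    rw [mem_Icc]
    constructor
    · have := (mem_filter.1 (Fintype.mem_piFinset.1 hp 0)).2
      exact this.trans_le (single_le_sum (f := fun i => (p i).1 + (p i).2)
        (fun _ _ => Nat.zero_le _) (mem_univ 0))
    · by_contra h
      refine hne ?_
      rw [hw _ p (by rw [length_word]; omega), smul_zero]
  have h3 : ∀ d ∈ Icc 1 l, (d : ℚ) • term d X Y = ∑ k ∈ range (K + 2),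
      ((-1 : ℚ) ^ k / (k + 1)) •
        ∑ p ∈ blocks d (k + 1), (∏ i, blockCoeff (p i)) • nested (word p X Y) := by
    intro d hd
    rw [mem_Icc] at hd
    have h4 : ∑ k ∈ range (K + 2), ((-1 : ℚ) ^ k / (k + 1)) •
        ∑ p ∈ blocks d (k + 1), (∏ i, blockCoeff (p i)) • nested (word p X Y) =
        ∑ k ∈ range d, ((-1 : ℚ) ^ k / (k + 1)) •
        ∑ p ∈ blocks d (k + 1), (∏ i, blockCoeff (p i)) • nested (word p X Y) := by
      symm
      refine sum_subset (fun k hk => ?_) fun k _ hk => ?_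
      · rw [mem_range] at hk ⊢; omega
      · rw [mem_range] at hk
        rw [blocks_eq_empty (by omega), sum_empty, smul_zero]
    rw [h4, term, sum_bij' (i := fun k _ => k - 1) (j := fun k _ => k + 1) (t := range d)
      (g := fun k => ∑ p ∈ blocks d (k + 1), ((-1 : ℚ) ^ k / (k + 1 : ℕ) *
      (1 / (d * ∏ i, ((Nat.factorial (p i).1 : ℚ) * (Nat.factorial (p i).2 : ℚ))))) •
      nested (word p X Y)), smul_sum]
    · refine sum_congr rfl fun k _ => ?_
      rw [smul_sum, smul_sum]
      refine sum_congr rfl fun p _ => ?_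
      rw [smul_smul, smul_smul]
      congr 1
      simp only [blockCoeff, prod_inv_distrib]
      have : (d : ℚ) ≠ 0 := by
        have : d ≠ 0 := by omega
        exact_mod_cast this
      push_cast
      field_simp
    · intro k hk; rw [mem_Icc] at hk; rw [mem_range]; omega
    · intro k hk; rw [mem_range] at hk; rw [mem_Icc]; omega
    · intro k hk; rw [mem_Icc] at hk; omega
    · intro k hk; omega
    · intro k hk
      rw [mem_Icc] at hk
      obtain ⟨k, rfl⟩ : ∃ k', k = k' + 1 := ⟨k - 1, by omega⟩
      rfl
  rw [sum_congr rfl h3, sum_comm, logDiv, map_sum, LinearMap.sum_apply]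
  refine sum_congr rfl fun k _ => ?_
  rw [map_mul, aeval_C, map_pow, aeval_X, ← Algebra.smul_def, LinearMap.smul_apply,
    exp_ad_mul_exp_ad_sub_one_pow_apply hX hY, h1, smul_sum]

end Lie

end BCH

/-! ### The Baker-Campbell-Hausdorff theorem in nilpotent associative algebras -/

namespace BCH

open Polynomial Finset NilpotentExpLog

attribute [local instance] LieRing.ofAssociativeRing

section Euler

variable {B : Type*} [Ring B] [Algebra ℚ B]

theorem aeval_expDiv_apply_of_apply_eq_zero {M : Type*} [AddCommGroup M] [Module ℚ M]
    {f : Module.End ℚ M} {v : M} (h : f v = 0) (N : ℕ) : aeval f (expDiv (N + 1)) v = v := by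
  rw [expDiv, sum_range_succ', map_add, map_sum, LinearMap.add_apply, LinearMap.sum_apply,
    sum_eq_zero, zero_add]
  · simp
  · intro i _
    rw [pow_succ, ← mul_assoc, map_mul, aeval_X, Module.End.mul_apply, h, map_zero]

theorem exp_ad_apply_euler {D Y : B} (hY : IsNilpotent Y) (hD : ⁅D, Y⁆ = Y) :
    IsNilpotent.exp (LieAlgebra.ad ℚ B Y) D = D - Y := by
  obtain ⟨n, hn⟩ := LieAlgebra.ad_nilpotent_of_nilpotent (R := ℚ) hY
  have hn' : (LieAlgebra.ad ℚ B Y) ^ (n + 1) = 0 := by rw [pow_succ, hn, zero_mul]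
  rw [exp_eq_one_add hn', LinearMap.add_apply, Module.End.one_apply, Module.End.mul_apply,
    LieAlgebra.ad_apply, ← lie_skew, hD, map_neg,
    aeval_expDiv_apply_of_apply_eq_zero (by rw [LieAlgebra.ad_apply, lie_self]), sub_eq_add_neg]

/-- The adjoint representation turns `exp Z = exp X * exp Y` into the same identity for `ad`. -/
theorem exp_ad_of_exp_eq_mul {X Y Z : B} (hX : IsNilpotent X) (hY : IsNilpotent Y)
    (hZ : IsNilpotent Z)
    (h : IsNilpotent.exp Z = IsNilpotent.exp X * IsNilpotent.exp Y) :
    IsNilpotent.exp (LieAlgebra.ad ℚ B Z) =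
      IsNilpotent.exp (LieAlgebra.ad ℚ B X) * IsNilpotent.exp (LieAlgebra.ad ℚ B Y) := by
  have h1 : IsNilpotent.exp (-Z) = IsNilpotent.exp (-Y) * IsNilpotent.exp (-X) := by
    refine (IsNilpotent.isUnit_exp hZ).mul_left_cancel ?_
    rw [IsNilpotent.exp_mul_exp_neg_self hZ, h, mul_assoc,
      ← mul_assoc (IsNilpotent.exp Y), IsNilpotent.exp_mul_exp_neg_self hY, one_mul,
      IsNilpotent.exp_mul_exp_neg_self hX]
  ext b
  rw [Module.End.mul_apply, exp_ad_apply hZ, exp_ad_apply hY, exp_ad_apply hX, h, h1]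
  simp only [mul_assoc]

/-- If `D` acts as an Euler derivation on `X` and `Y`, then computing `exp Z * D * exp (-Z)` in two
ways, where `exp Z = exp X * exp Y`, determines `⁅D, Z⁆`. -/
theorem lie_euler {D X Y Z : B} (hX : IsNilpotent X) (hY : IsNilpotent Y)
    (hZ : IsNilpotent Z) (h : IsNilpotent.exp Z = IsNilpotent.exp X * IsNilpotent.exp Y)
    (hDX : ⁅D, X⁆ = X) (hDY : ⁅D, Y⁆ = Y) {K : ℕ} (hK : (LieAlgebra.ad ℚ B Z) ^ K = 0) :
    ⁅D, Z⁆ = aeval (IsNilpotent.exp (LieAlgebra.ad ℚ B X) *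
        IsNilpotent.exp (LieAlgebra.ad ℚ B Y) - 1) (logDiv K)
      (X + IsNilpotent.exp (LieAlgebra.ad ℚ B X) Y) := by
  have hw := exp_ad_of_exp_eq_mul hX hY hZ h
  have h1 : IsNilpotent.exp (LieAlgebra.ad ℚ B Z) D =
      D - aeval (LieAlgebra.ad ℚ B Z) (expDiv K) ⁅D, Z⁆ := by
    rw [exp_eq_one_add hK, LinearMap.add_apply, Module.End.one_apply, Module.End.mul_apply,
      LieAlgebra.ad_apply, ← lie_skew, map_neg, sub_eq_add_neg]
  rw [hw, Module.End.mul_apply, exp_ad_apply_euler hY hDY, map_sub, exp_ad_apply_euler hX hDX,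
    sub_sub] at h1
  rw [sub_right_inj.1 h1, ← hw, ← Module.End.mul_apply, logDiv_mul_expDiv hK, Module.End.one_apply]

end Euler

section Filtered

variable {A : Type*} [Ring A] [Algebra ℚ A]

theorem nested_mem_filtration {F : ℕ → Submodule ℚ A}
    (hmul : ∀ i j x y, x ∈ F i → y ∈ F j → x * y ∈ F (i + j)) (w : List A)
    (hw : ∀ x ∈ w, x ∈ F 1) : nested w ∈ F w.length := by
  induction w with
  | nil => exact zero_mem _
  | cons x t ih =>
    cases t with
    | nil => exact hw x (by simp)
    | cons y t =>
      have h1 := ih fun z hz => hw z (List.mem_cons_of_mem _ hz)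
      have h2 := hw x (by simp)
      rw [nested, Ring.lie_def]
      refine sub_mem ?_ (hmul _ _ _ _ h1 h2)
      rw [List.length_cons, add_comm]
      exact hmul _ _ _ _ h2 h1

/-- The polynomials without constant term, all of whose coefficients lie in a given subspace. -/
def polyNoConst (S : Submodule ℚ A) : Submodule ℚ A[X] where
  carrier := {f | f.coeff 0 = 0 ∧ ∀ n, f.coeff n ∈ S}
  zero_mem' := ⟨rfl, fun _ => by simp⟩
  add_mem' hf hg := ⟨by simp [hf.1, hg.1], fun n => by simpa using add_mem (hf.2 n) (hg.2 n)⟩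
  smul_mem' c f hf := ⟨by simp [hf.1], fun n => by
    rw [coeff_smul]; exact S.smul_mem c (hf.2 n)⟩

theorem coeff_mul_mem {F : ℕ → Submodule ℚ A}
    (hmul : ∀ i j x y, x ∈ F i → y ∈ F j → x * y ∈ F (i + j)) {i j : ℕ} {f g : A[X]}
    (hf : ∀ n, f.coeff n ∈ F i) (hg : ∀ n, g.coeff n ∈ F j) (n : ℕ) :
    (f * g).coeff n ∈ F (i + j) := by
  rw [coeff_mul]
  exact sum_mem fun x _ => hmul _ _ _ _ (hf _) (hg _)

theorem coeff_pow_mem {F : ℕ → Submodule ℚ A}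
    (hmul : ∀ i j x y, x ∈ F i → y ∈ F j → x * y ∈ F (i + j))
    {f : A[X]} (hf : ∀ n, f.coeff n ∈ F 1) (k n : ℕ) :
    (f ^ (k + 1)).coeff n ∈ F (k + 1) := by
  induction k generalizing n with
  | zero => simpa using hf n
  | succ k ih => rw [pow_succ]; exact coeff_mul_mem hmul ih hf n

theorem pow_eq_zero_of_mem_polyNoConst {F : ℕ → Submodule ℚ A}
    (hmul : ∀ i j x y, x ∈ F i → y ∈ F j → x * y ∈ F (i + j))
    {l : ℕ} (hF : F (l + 1) = ⊥) {f : A[X]}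
    (hf : f ∈ polyNoConst (F 1)) : f ^ (l + 1) = 0 := by
  ext n
  have := coeff_pow_mem hmul hf.2 l n
  rwa [hF, Submodule.mem_bot] at this

theorem pow_eq_zero_of_mem {F : ℕ → Submodule ℚ A}
    (hmul : ∀ i j x y, x ∈ F i → y ∈ F j → x * y ∈ F (i + j))
    {l : ℕ} (hF : F (l + 1) = ⊥) {x : A}
    (hx : x ∈ F 1) : x ^ (l + 1) = 0 := by
  have h : ∀ k, x ^ (k + 1) ∈ F (k + 1) := by
    intro k
    induction k with
    | zero => simpa using hx
    | succ k ih => rw [pow_succ]; exact hmul _ _ _ _ ih hx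
  have := h l
  rwa [hF, Submodule.mem_bot] at this

theorem mul_mem_polyNoConst {F : ℕ → Submodule ℚ A}
    (hmul : ∀ i j x y, x ∈ F i → y ∈ F j → x * y ∈ F (i + j))
    (hanti : Antitone F) {f g : A[X]} (hf : f ∈ polyNoConst (F 1))
    (hg : g ∈ polyNoConst (F 1)) : f * g ∈ polyNoConst (F 1) :=
  ⟨by rw [mul_coeff_zero, hf.1, zero_mul],
    fun n => hanti (show 1 ≤ 1 + 1 by omega) (coeff_mul_mem hmul hf.2 hg.2 n)⟩

theorem aeval_mul_mem_polyNoConst {F : ℕ → Submodule ℚ A}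
    (hmul : ∀ i j x y, x ∈ F i → y ∈ F j → x * y ∈ F (i + j))
    (hanti : Antitone F) {f : A[X]} (hf : f ∈ polyNoConst (F 1)) (p : ℚ[X]) :
    aeval f p * f ∈ polyNoConst (F 1) := by
  induction p using Polynomial.induction_on' with
  | add p q hp hq => rw [map_add, add_mul]; exact add_mem hp hq
  | monomial n a =>
    rw [aeval_monomial, ← Algebra.smul_def, smul_mul_assoc]
    refine Submodule.smul_mem _ _ ?_
    induction n with
    | zero => simpa using hf
    | succ n ih => rw [pow_succ]; exact mul_mem_polyNoConst hmul hanti ih hf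

theorem nested_map_C_mul_X {R : Type*} [Ring R] (w : List R) :
    nested (w.map fun x => (C x * X : R[X])) = C (nested w) * X ^ w.length := by
  induction w with
  | nil => simp [nested]
  | cons x t ih =>
    cases t with
    | nil => simp [nested]
    | cons y t =>
      rw [List.map_cons, nested_cons _ (List.map_eq_nil_iff.not.2 (List.cons_ne_nil y t)), ih,
        nested_cons _ (List.cons_ne_nil y t), List.length_cons (a := x)]
      generalize nested (y :: t) = v
      generalize (y :: t).length = n
      rw [Ring.lie_def, Ring.lie_def, C_sub, C_mul, C_mul, sub_mul]
      congr 1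
      · rw [mul_assoc, ← mul_assoc X, X_mul_C, pow_succ']
        simp only [mul_assoc]
      · rw [mul_assoc, ← mul_assoc (X ^ n), X_pow_mul_C, pow_succ]
        simp only [mul_assoc]

theorem term_C_mul_X (d : ℕ) (x y : A) :
    term d (C x * X : A[X]) (C y * X) = C (term d x y) * X ^ d := by
  simp only [term, map_sum, sum_mul]
  refine sum_congr rfl fun k _ => sum_congr rfl fun p hp => ?_
  rw [← map_word (fun x => (C x * X : A[X])), nested_map_C_mul_X, length_word,
    (mem_filter.1 hp).2.2, ← smul_C, smul_mul_assoc]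

/-- The Euler derivation `X d/dX` on polynomials. -/
noncomputable def euler : Module.End ℚ A[X] where
  toFun f := X * derivative f
  map_add' f g := by rw [derivative_add, mul_add]
  map_smul' c f := by rw [derivative_smul, mul_smul_comm, RingHom.id_apply]

theorem lie_euler_lmul (f : A[X]) :
    ⁅(euler : Module.End ℚ A[X]), Algebra.lmul ℚ A[X] f⁆ =
      Algebra.lmul ℚ A[X] (X * derivative f) := by
  ext1 g
  rw [Ring.lie_def, LinearMap.sub_apply, Module.End.mul_apply, Module.End.mul_apply]
  show X * derivative (f * g) - f * (X * derivative g) = X * derivative f * g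
  rw [derivative_mul, mul_add, ← mul_assoc f X, ← X_mul, ← mul_assoc, ← mul_assoc,
    add_sub_cancel_right]

/-- **Baker-Campbell-Hausdorff theorem** in Dynkin's form, for elements of positive filtration
degree in a filtered associative algebra. -/
theorem exp_mul_exp_eq_exp_bch {F : ℕ → Submodule ℚ A}
    (hmul : ∀ i j x y, x ∈ F i → y ∈ F j → x * y ∈ F (i + j))
    (hanti : Antitone F) {l : ℕ} (hF : F (l + 1) = ⊥) {x y : A} (hx : x ∈ F 1)
    (hy : y ∈ F 1) :
    IsNilpotent.exp x * IsNilpotent.exp y = IsNilpotent.exp (bch l x y) := by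
  have hmem : ∀ x ∈ F 1, (C x * X : A[X]) ∈ polyNoConst (F 1) := by
    refine fun x hx => ⟨by simp, fun n => ?_⟩
    rw [coeff_C_mul, coeff_X]
    split_ifs
    · simpa using hx
    · simp
  have hnil : ∀ f ∈ polyNoConst (F 1), f ^ (l + 1) = 0 :=
    fun f hf => pow_eq_zero_of_mem_polyNoConst hmul hF hf
  have hexp : ∀ f ∈ polyNoConst (F 1), IsNilpotent.exp f - 1 ∈ polyNoConst (F 1) := by
    intro f hf
    rw [exp_eq_one_add (hnil f hf), add_sub_cancel_left]
    exact aeval_mul_mem_polyNoConst hmul hanti hf _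
  -- The variable `X` of `A[X]` records the degree in the two elements.
  set P : A[X] := C x * X with hP
  set Q : A[X] := C y * X with hQ
  have hPm : P ∈ polyNoConst (F 1) := hmem x hx
  have hQm : Q ∈ polyNoConst (F 1) := hmem y hy
  have hN : IsNilpotent.exp P * IsNilpotent.exp Q - 1 ∈ polyNoConst (F 1) := by
    have h := add_mem (add_mem (mul_mem_polyNoConst hmul hanti (hexp P hPm) (hexp Q hQm))
      (hexp P hPm)) (hexp Q hQm)
    convert h using 1
    noncomm_ring
  obtain ⟨Z, hZm, hZ⟩ : ∃ Z ∈ polyNoConst (F 1),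
      IsNilpotent.exp Z = IsNilpotent.exp P * IsNilpotent.exp Q := by
    refine ⟨aeval (IsNilpotent.exp P * IsNilpotent.exp Q - 1) (logPoly (l + 1)), ?_, ?_⟩
    · rw [logPoly, mul_comm, map_mul, aeval_X]
      exact aeval_mul_mem_polyNoConst hmul hanti hN _
    · rw [exp_log (hnil _ hN), add_sub_cancel]
  -- Left multiplication transports everything to endomorphisms, where the Euler derivation lives.
  set Φ := Algebra.lmul ℚ A[X] with hΦ
  have hΦnil : ∀ f ∈ polyNoConst (F 1), IsNilpotent (Φ f) :=
    fun f hf => IsNilpotent.map ⟨_, hnil f hf⟩ Φ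
  have hD : ∀ x : A, ⁅(euler : Module.End ℚ A[X]), Φ (C x * X)⁆ = Φ (C x * X) := by
    intro x
    rw [hΦ, lie_euler_lmul, derivative_C_mul, derivative_X, mul_one, X_mul_C]
  have hadnil : ∀ f ∈ polyNoConst (F 1), IsNilpotent (LieAlgebra.ad ℚ (Module.End ℚ A[X]) (Φ f)) :=
    fun f hf => LieAlgebra.ad_nilpotent_of_nilpotent (hΦnil f hf)
  obtain ⟨k1, hk1⟩ := hadnil P hPm
  obtain ⟨k2, hk2⟩ := hadnil Q hQm
  obtain ⟨k3, hk3⟩ := hadnil Z hZm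
  have hexpΦ : IsNilpotent.exp (Φ Z) = IsNilpotent.exp (Φ P) * IsNilpotent.exp (Φ Q) := by
    rw [← IsNilpotent.map_exp ⟨_, hnil _ hZm⟩, ← IsNilpotent.map_exp ⟨_, hnil _ hPm⟩,
      ← IsNilpotent.map_exp ⟨_, hnil _ hQm⟩, hZ, map_mul]
  have hlie := lie_euler (hΦnil P hPm) (hΦnil Q hQm) (hΦnil Z hZm) hexpΦ (hD x) (hD y)
    (pow_eq_zero_of_le (show k3 ≤ (k1 + k2 + k3 + l) + 2 by omega) hk3)
  rw [aeval_logDiv_apply_eq_sum_term (l := l) (by omega)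
    (pow_eq_zero_of_le (by omega) hk1) (pow_eq_zero_of_le (by omega) hk2), hΦ, lie_euler_lmul,
    ← hΦ] at hlie
  · have hterm : ∀ d, term d (Φ P) (Φ Q) = Φ (C (term d x y) * X ^ d) := fun d => by
      rw [← term_C_mul_X]
      exact (map_term Φ.toLieHom d P Q).symm
    simp_rw [hterm, ← map_smul, ← map_sum] at hlie
    have hlie' := Algebra.lmul_injective hlie
    -- In each positive degree `d`, the Euler derivation acts by the invertible scalar `d`.
    have hZeq : Z = ∑ d ∈ Icc 1 l, C (term d x y) * X ^ d := by
      ext n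
      have hn := congrArg (fun f : A[X] => f.coeff n) hlie'
      rcases n with _ | n
      · rw [hZm.1, finsetSum_coeff, sum_eq_zero]
        intro d hd
        rw [mem_Icc] at hd
        rw [coeff_C_mul, coeff_X_pow, if_neg (by omega), mul_zero]
      · simp only [coeff_X_mul, coeff_derivative, finsetSum_coeff, coeff_smul, coeff_C_mul,
          coeff_X_pow, mul_ite, mul_one, mul_zero, smul_ite, smul_zero, sum_ite_eq] at hn ⊢
        have h1 : ((n + 1 : ℕ) : ℚ) ≠ 0 := by positivity
        have h2 : Z.coeff (n + 1) * ((n : A) + 1) = ((n + 1 : ℕ) : ℚ) • Z.coeff (n + 1) := by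
          rw [Nat.cast_smul_eq_nsmul, nsmul_eq_mul', Nat.cast_succ]
        rw [h2] at hn
        refine smul_right_injective A h1 ?_
        show ((n + 1 : ℕ) : ℚ) • Z.coeff (n + 1) = ((n + 1 : ℕ) : ℚ) • _
        rw [hn, smul_ite, smul_zero]
    -- Setting the grading variable to `1` recovers the elements of `A`.
    let ev : A[X] →+* A := eval₂RingHom' (RingHom.id A) 1 fun a => Commute.one_right a
    have hevC : ∀ a n, ev (C a * X ^ n) = a := fun a n => by simp [ev]
    have hevC1 : ∀ a, ev (C a * X) = a := fun a => by simp [ev]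
    have h := congrArg ev hZ
    rw [map_mul, IsNilpotent.map_exp ⟨_, hnil _ hZm⟩, IsNilpotent.map_exp ⟨_, hnil _ hPm⟩,
      IsNilpotent.map_exp ⟨_, hnil _ hQm⟩, hP, hQ, hevC1, hevC1, hZeq, map_sum] at h
    simp only [hevC] at h
    exact h.symm
  · intro k p hp
    rw [length_word] at hp
    have h1 : nested (word p (Φ P) (Φ Q)) = Φ (nested (word p P Q)) := by
      rw [← map_word]; exact (map_nested Φ.toLieHom _).symm
    rw [h1, ← map_word (fun x => (C x * X : A[X])), nested_map_C_mul_X]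
    have h2 := nested_mem_filtration hmul (word p x y) (fun z hz => by
      rcases mem_word p x y z hz with rfl | rfl <;> assumption)
    rw [length_word] at h2
    have h3 := hanti (show l + 1 ≤ _ from hp) h2
    rw [hF, Submodule.mem_bot] at h3
    rw [h3, C_0, zero_mul, map_zero]

end Filtered

end BCH

/-! ### Central perturbations of the Baker-Campbell-Hausdorff product -/

namespace BCH

variable {L : Type*} [LieRing L]

/-- A nested bracket of at least two entries depends only on how the entries act by brackets. -/
theorem nested_map_congr {α : Type*} {f g : α → L} (h : ∀ i (c : L), ⁅f i, c⁆ = ⁅g i, c⁆) (v : List α)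
    (hv : 2 ≤ v.length) : nested (v.map f) = nested (v.map g) := by
  induction v with
  | nil => simp at hv
  | cons a t ih =>
    cases t with
    | nil => simp at hv
    | cons b t =>
      cases t with
      | nil =>
        simp only [List.map_cons, List.map_nil, nested]
        rw [h, ← lie_skew, h, lie_skew]
      | cons c t =>
        have h1 := ih (by simp)
        simp only [List.map_cons, nested] at h1 ⊢
        rw [h, h1]

variable [LieAlgebra ℚ L]

theorem term_congr {X X' Y Y' : L} (hX : ∀ c : L, ⁅X, c⁆ = ⁅X', c⁆)
    (hY : ∀ c : L, ⁅Y, c⁆ = ⁅Y', c⁆)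
    {d : ℕ} (hd : 2 ≤ d) : term d X Y = term d X' Y' := by
  refine Finset.sum_congr rfl fun k _ => Finset.sum_congr rfl fun p hp => ?_
  have hmap : ∀ X Y : L, word p X Y = (word p true false).map fun b => cond b X Y :=
    fun X Y => (map_word (fun b => cond b X Y) p true false).symm
  rw [hmap X, hmap X', nested_map_congr (g := fun b => cond b X' Y')]
  · rintro (_ | _)
    · exact hY
    · exact hX
  · rwa [length_word, (Finset.mem_filter.1 hp).2.2]

theorem bch_eq_add_sum {l : ℕ} (hl : 1 ≤ l) (X Y : L) :
    bch l X Y = X + Y + ∑ d ∈ (Finset.Icc 1 l).erase 1, term d X Y := by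
  rw [bch, ← term_one X Y, Finset.add_sum_erase _ (fun d => term d X Y) (by simp [hl])]

/-- Central elements enter the Baker-Campbell-Hausdorff product additively. -/
theorem bch_add_central {l : ℕ} (hl : 1 ≤ l) (X Y : L) {z z' : L} (hz : ∀ c : L, ⁅z, c⁆ = 0)
    (hz' : ∀ c : L, ⁅z', c⁆ = 0) : bch l (X + z) (Y + z') = bch l X Y + (z + z') := by
  rw [bch_eq_add_sum hl, bch_eq_add_sum hl, Finset.sum_congr rfl fun d hd =>
    term_congr (X := X + z) (X' := X) (Y := Y + z') (Y' := Y) (fun c => by rw [add_lie, hz, add_zero])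
    (fun c => by rw [add_lie, hz', add_zero]) (by
      rw [Finset.mem_erase, Finset.mem_Icc] at hd; omega)]
  abel

end BCH

/-! ### Existence and uniqueness of ordered factorizations -/

namespace GradedLie

theorem coeff_X (p q : NPlus) : coeff p (X q) = if q = p then 1 else 0 := by
  classical
  exact Finsupp.single_apply.trans (by congr)

theorem coeff_eq_zero_of_mem {l : ℕ} {x : GradedLie} (hx : x ∈ gtSubmodule l) {p : NPlus}
    (hp : p.deg ≤ l) : coeff p x = 0 := by
  have : gtSubmodule l ≤ LinearMap.ker (coeff p) := by
    refine Submodule.span_le.2 ?_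
    rintro _ ⟨q, hq, rfl⟩
    simp only [Set.mem_ofPred_eq] at hq
    rw [SetLike.mem_coe, LinearMap.mem_ker, coeff_X, if_neg (by rintro rfl; omega)]
  exact this hx

/-- The combination of the `X_p` of degree `d` with coefficients `u p`. -/
noncomputable def homogeneous (d : ℕ) (u : NPlus → ℚ) : GradedLie :=
  ∑ p ∈ (NPlus.degLE d).filter fun p => p.deg = d, u p • X p

/-- An element of `𝔤^{> l}` is congruent to its part of degree `l + 1` modulo `𝔤^{> l + 1}`. -/
theorem sub_homogeneous_mem {l : ℕ} {z : GradedLie} (hz : z ∈ gtSubmodule l) :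
    z - homogeneous (l + 1) (fun p => coeff p z) ∈ gtSubmodule (l + 1) := by
  induction hz using Submodule.span_induction with
  | mem x h =>
    obtain ⟨q, hq, rfl⟩ := h
    simp only [Set.mem_ofPred_eq] at hq
    simp only [homogeneous, coeff_X, ite_smul, one_smul, zero_smul, Finset.sum_ite_eq]
    split_ifs with h
    · rw [sub_self]; exact zero_mem _
    · rw [sub_zero]
      refine X_mem_gtSubmodule ?_
      simp only [Finset.mem_filter, NPlus.mem_degLE] at h
      omega
  | zero => simp [homogeneous]
  | add x y _ _ hx hy =>
    convert add_mem hx hy using 1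
    simp only [homogeneous, map_add, add_smul, Finset.sum_add_distrib]
    abel
  | smul c x _ hx =>
    convert Submodule.smul_mem _ c hx using 1
    simp only [homogeneous, map_smul, smul_sub, Finset.smul_sum, smul_smul, smul_eq_mul]

theorem coeff_homogeneous (u : NPlus → ℚ) (p : NPlus) :
    coeff p (homogeneous p.deg u) = u p := by
  rw [homogeneous, map_sum, Finset.sum_eq_single p]
  · simp [coeff_X]
  · intro q _ hq
    rw [map_smul, coeff_X, if_neg hq, smul_zero]
  · intro h
    refine (h ?_).elim
    rw [Finset.mem_filter, NPlus.mem_degLE]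
    exact ⟨le_rfl, rfl⟩

theorem lie_toLe_eq_zero {l : ℕ} {z : GradedLie} (hz : z ∈ gtSubmodule l) (c : Le (l + 1)) :
    ⁅toLe (l + 1) z, c⁆ = 0 := by
  obtain ⟨c, rfl⟩ := toLe_surjective _ c
  rw [← LieHom.map_lie, ← lie_skew, map_neg, toLe_eq_zero.2 (lie_mem_gtSubmodule c hz), neg_zero]

end GradedLie

namespace GroupLe

open GradedLie

theorem list_prod_log {α : Type*} {l : ℕ} (t : List α) (f : α → Le (l + 1)) (z : α → Le (l + 1))
    (hz : ∀ i (c : Le (l + 1)), ⁅z i, c⁆ = 0) :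
    ((t.map fun i => (exp (f i + z i) : GroupLe (l + 1))).prod).log =
      ((t.map fun i => (exp (f i) : GroupLe (l + 1))).prod).log + (t.map z).sum := by
  have hsum : ∀ (t : List α) (c : Le (l + 1)), ⁅(t.map z).sum, c⁆ = 0 := by
    intro t c
    induction t with
    | nil => exact zero_lie c
    | cons i t ih => rw [List.map_cons, List.sum_cons, add_lie, hz, ih, add_zero]
  induction t with
  | nil => exact (add_zero _).symm
  | cons i t ih =>
    simp only [List.map_cons, List.prod_cons, List.sum_cons]
    show BCH.bch (l + 1) _ _ = BCH.bch (l + 1) _ _ + _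
    rw [ih, BCH.bch_add_central (by omega) _ _ (hz i) (hsum t)]

end GroupLe

namespace StructureGroup

open GradedLie

theorem log_π_Ψ_of_deg (n : NPlus) {l : ℕ} (h : n.deg = l + 1) :
    ((Ψ n).π (l + 1)).log = toLe (l + 1) (X n) := by
  show toLe (l + 1) _ = _
  rw [Finset.sum_range_succ', map_add, map_sum, Finset.sum_eq_zero, zero_add]
  · have : NPlus.succMul 0 n = n := by ext <;> simp [NPlus.succMul]
    simp [this]
  · intro i _
    rw [map_smul, toLe_eq_zero.2 (X_mem_gtSubmodule _), smul_zero]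
    have : (NPlus.succMul (i + 1) n).deg = (i + 1 + 1) * n.deg := by
      simp only [NPlus.succMul, NPlus.deg]; ring
    rw [this, h]
    nlinarith

/-- Changing the exponents in top degree multiplies by a central element. -/
theorem log_π_orderedProd_succ {l : ℕ} {u v : NPlus → ℚ} (h : ∀ p, p.deg ≤ l → u p = v p) :
    ((orderedProd u).π (l + 1)).log = ((orderedProd v).π (l + 1)).log +
      toLe (l + 1) (homogeneous (l + 1) (fun p => u p - v p)) := by
  let z : NPlus → Le (l + 1) := fun p =>
    if p.deg = l + 1 then toLe (l + 1) ((u p - v p) • X p) else 0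
  have hz : ∀ p (c : Le (l + 1)), ⁅z p, c⁆ = 0 := by
    intro p c
    simp only [z]
    split_ifs with hp
    · exact lie_toLe_eq_zero (Submodule.smul_mem _ _ (X_mem_gtSubmodule (by omega))) c
    · exact zero_lie c
  have hfac : ∀ p ∈ (NPlus.degLE (l + 1)).sort (· ≤ ·), (Ψ p).π (l + 1) ^ u p =
      (GroupLe.exp (v p • ((Ψ p).π (l + 1)).log + z p) : GroupLe (l + 1)) := by
    intro p hp
    rw [Finset.mem_sort, NPlus.mem_degLE] at hp
    refine GroupLe.ext ?_
    show u p • ((Ψ p).π (l + 1)).log = v p • ((Ψ p).π (l + 1)).log + z p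
    simp only [z]
    split_ifs with hd
    · rw [log_π_Ψ_of_deg p hd, map_smul, sub_smul, add_sub_cancel]
    · rw [h p (by omega), add_zero]
  have hsum : (((NPlus.degLE (l + 1)).sort (· ≤ ·)).map z).sum =
      toLe (l + 1) (homogeneous (l + 1) (fun p => u p - v p)) := by
    rw [← List.sum_toFinset z (Finset.sort_nodup _ _), Finset.sort_toFinset, homogeneous, map_sum,
      Finset.sum_filter]
  show ((((NPlus.degLE (l + 1)).sort (· ≤ ·)).map fun n => (Ψ n).π (l + 1) ^ u n).prod).log = _
  rw [List.map_congr_left hfac, GroupLe.list_prod_log _ _ _ hz, hsum]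
  rfl

theorem π_zero (g h : StructureGroup) : g.π 0 = h.π 0 := by
  refine GroupLe.ext ?_
  obtain ⟨x, hx⟩ := toLe_surjective _ (g.π 0).log
  obtain ⟨y, hy⟩ := toLe_surjective _ (h.π 0).log
  have h0 : ∀ x, toLe 0 x = 0 := fun x => by
    rw [toLe_eq_zero, gtSubmodule_zero]; trivial
  rw [← hx, ← hy, h0, h0]

theorem eq_of_π_orderedProd_eq {u v : NPlus → ℚ} {l : ℕ}
    (h : (orderedProd u).π l = (orderedProd v).π l) : ∀ p : NPlus, p.deg ≤ l → u p = v p := by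
  induction l with
  | zero => intro p hp; have := p.deg_pos; omega
  | succ l ih =>
    have hlow := ih (by rw [← (orderedProd u).compat, h, (orderedProd v).compat])
    intro p hp
    rcases Nat.lt_or_ge l p.deg with hd | hd
    · have hd : p.deg = l + 1 := by omega
      have h1 := log_π_orderedProd_succ hlow
      rw [h, left_eq_add, toLe_eq_zero] at h1
      have h2 := coeff_eq_zero_of_mem h1 hp
      rw [← hd, coeff_homogeneous] at h2
      linarith
    · exact hlow p hd

theorem π_orderedProd_congr {u v : NPlus → ℚ} {l : ℕ} (h : ∀ p : NPlus, p.deg ≤ l → u p = v p) :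
    (orderedProd u).π l = (orderedProd v).π l := by
  show (List.map _ _).prod = (List.map _ _).prod
  congr 1
  refine List.map_congr_left fun p hp => ?_
  rw [Finset.mem_sort, NPlus.mem_degLE] at hp
  rw [h p hp]

theorem exists_π_orderedProd_eq (g : StructureGroup) (l : ℕ) :
    ∃ u, g.π l = (orderedProd u).π l := by
  induction l with
  | zero => exact ⟨0, π_zero _ _⟩
  | succ l ih =>
    obtain ⟨v, hv⟩ := ih
    obtain ⟨x, hx⟩ := toLe_surjective _ (g.π (l + 1)).log
    obtain ⟨y, hy⟩ := toLe_surjective _ ((orderedProd v).π (l + 1)).log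
    have hz : x - y ∈ gtSubmodule l := by
      rw [← g.compat, ← (orderedProd v).compat] at hv
      have h1 : proj l (g.π (l + 1)).log = proj l ((orderedProd v).π (l + 1)).log :=
        congrArg GroupLe.log hv
      rw [← hx, ← hy, proj_toLe, proj_toLe] at h1
      rw [← toLe_eq_zero, map_sub, h1, sub_self]
    refine ⟨fun p => if p.deg ≤ l then v p else v p + coeff p (x - y), GroupLe.ext ?_⟩
    rw [log_π_orderedProd_succ (v := v) (fun p hp => if_pos hp), ← hx, ← hy, ← sub_eq_iff_eq_add',
      ← map_sub, ← sub_eq_zero, ← map_sub, toLe_eq_zero]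
    convert sub_homogeneous_mem hz using 2
    refine Finset.sum_congr rfl fun p hp => ?_
    have hd := (Finset.mem_filter.1 hp).2
    simp only [show ¬p.deg ≤ l by omega, if_false, add_sub_cancel_left]

theorem π_eq_of_π_add_eq {g h : StructureGroup} {j : ℕ} (i : ℕ)
    (e : g.π (j + i) = h.π (j + i)) : g.π j = h.π j := by
  induction i with
  | zero => exact e
  | succ i ih =>
    refine ih ?_
    rw [← g.compat, ← h.compat]
    exact congrArg GroupLe.proj e

/-- Every element of the structure group is an ordered product of powers of the dilogarithm
elements in exactly one way. -/
theorem existsUnique_orderedProd (g : StructureGroup) : ∃! u, g = orderedProd u := by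
  choose w hw using exists_π_orderedProd_eq g
  -- The exponent at `p` is determined in `G^{≤ deg p}`.
  refine ⟨fun p => w p.deg p, StructureGroup.ext (funext fun l => ?_),
    fun v hv => funext fun p => ?_⟩
  · rw [hw l]
    refine π_orderedProd_congr fun p hp => ?_
    refine eq_of_π_orderedProd_eq (l := p.deg) ?_ p le_rfl
    have h1 : g.π (p.deg + (l - p.deg)) = (orderedProd (w l)).π (p.deg + (l - p.deg)) := by
      rw [Nat.add_sub_cancel' hp, hw l]
    rw [← π_eq_of_π_add_eq _ h1, hw p.deg]
  · refine eq_of_π_orderedProd_eq (l := p.deg) ?_ p le_rfl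
    rw [← hv, hw p.deg]

end StructureGroup

/-! ### The Poisson representation on truncated polynomials -/

namespace PoissonRep

open GradedLie

attribute [local instance] LieRing.ofAssociativeRing

/-- The functions on the box `[0, N] × [0, 2]`, that is, the coefficient functions of polynomials
modulo `x ^ (N + 1)` and `y ^ 3`. -/
abbrev Vec (N : ℕ) : Type := Fin (N + 1) × Fin 3 → ℚ

/-- The action of `X_p`: it maps the monomial with exponent `q` to `{p, q}` times the monomial with
exponent `p + q`. -/
def monoOp (N : ℕ) (p : NPlus) : Module.End ℚ (Vec N) where
  toFun f q := if p.a ≤ q.1 ∧ p.b ≤ q.2 then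
    ((p.b : ℚ) * (q.1 : ℕ) - p.a * (q.2 : ℕ)) *
      f (⟨q.1 - p.a, lt_of_le_of_lt (Nat.sub_le _ _) q.1.2⟩,
        ⟨q.2 - p.b, lt_of_le_of_lt (Nat.sub_le _ _) q.2.2⟩) else 0
  map_add' f g := by
    ext q
    simp only [Pi.add_apply]
    split_ifs
    · ring
    · simp
  map_smul' c f := by
    ext q
    simp only [Pi.smul_apply, smul_eq_mul, RingHom.id_apply]
    split_ifs
    · ring
    · simp

theorem monoOp_apply (N : ℕ) (p : NPlus) (f : Vec N) (q : Fin (N + 1) × Fin 3) :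
    monoOp N p f q = if p.a ≤ q.1 ∧ p.b ≤ q.2 then
    ((p.b : ℚ) * (q.1 : ℕ) - p.a * (q.2 : ℕ)) *
      f (⟨q.1 - p.a, lt_of_le_of_lt (Nat.sub_le _ _) q.1.2⟩,
        ⟨q.2 - p.b, lt_of_le_of_lt (Nat.sub_le _ _) q.2.2⟩) else 0 := rfl

theorem monoOp_mul_apply (N : ℕ) (p r : NPlus) (f : Vec N) (q : Fin (N + 1) × Fin 3) :
    monoOp N p (monoOp N r f) q = if p.a + r.a ≤ q.1 ∧ p.b + r.b ≤ q.2 then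
    ((p.b : ℚ) * (q.1 : ℕ) - p.a * (q.2 : ℕ)) *
      (((r.b : ℚ) * ((q.1 : ℕ) - p.a) - r.a * ((q.2 : ℕ) - p.b)) *
      f (⟨q.1 - (p.a + r.a), lt_of_le_of_lt (Nat.sub_le _ _) q.1.2⟩,
        ⟨q.2 - (p.b + r.b), lt_of_le_of_lt (Nat.sub_le _ _) q.2.2⟩)) else 0 := by
  rw [monoOp_apply]
  by_cases h : p.a ≤ q.1 ∧ p.b ≤ q.2
  · rw [if_pos h, monoOp_apply]
    by_cases h' : p.a + r.a ≤ q.1 ∧ p.b + r.b ≤ q.2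
    · rw [if_pos h', if_pos (by simp only; omega)]
      simp only [Nat.sub_sub, Nat.cast_sub h.1, Nat.cast_sub h.2]
    · rw [if_neg h', if_neg (by simp only; omega), mul_zero]
  · rw [if_neg h, if_neg (by omega)]

/-- The representation of `𝔤` by Poisson brackets on polynomials modulo `x ^ (N + 1)` and `y ^ 3`. -/
noncomputable def rep (N : ℕ) : GradedLie →ₗ[ℚ] Module.End ℚ (Vec N) :=
  Finsupp.linearCombination ℚ (monoOp N)

theorem rep_X (N : ℕ) (p : NPlus) : rep N (X p) = monoOp N p :=
  (Finsupp.linearCombination_single ℚ (1 : ℚ) p (v := monoOp N)).trans (one_smul _ _)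

theorem rep_lie (N : ℕ) (x y : GradedLie) : rep N ⁅x, y⁆ = ⁅rep N x, rep N y⁆ := by
  have h1 : ∀ p q, rep N ⁅X p, X q⁆ = ⁅rep N (X p), rep N (X q)⁆ := by
    intro p r
    rw [lie_X, map_smul, rep_X, rep_X, rep_X, Ring.lie_def]
    refine LinearMap.ext fun f => funext fun q => ?_
    rw [LinearMap.sub_apply, Pi.sub_apply, Module.End.mul_apply, Module.End.mul_apply,
      monoOp_mul_apply, monoOp_mul_apply, LinearMap.smul_apply, Pi.smul_apply, monoOp_apply]
    simp only [NPlus.add_a, NPlus.add_b, add_comm r.a, add_comm r.b, NPlus.form, smul_eq_mul]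
    split_ifs
    · push_cast
      ring
    · simp
  have h2 : ∀ p y, rep N ⁅X p, y⁆ = ⁅rep N (X p), rep N y⁆ := by
    intro p y
    have : (rep N).comp (lieMap (X p)) =
        (LieAlgebra.ad ℚ (Module.End ℚ (Vec N)) (rep N (X p))).comp (rep N) :=
      hom_ext fun q => h1 p q
    exact LinearMap.congr_fun this y
  have : (rep N).comp (lieMap.flip y) =
      -(LieAlgebra.ad ℚ (Module.End ℚ (Vec N)) (rep N y)).comp (rep N) :=
    hom_ext fun p => (h2 p y).trans (lie_skew _ _).symm
  refine (LinearMap.congr_fun this x).trans ?_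
  exact lie_skew _ _

/-- The operators raising the weight `wt` by at least `i`: if `f` is supported in weights `≥ j`, its
image is supported in weights `≥ i + j`. -/
def filt {N : ℕ} (wt : Fin (N + 1) × Fin 3 → ℕ) (i : ℕ) :
    Submodule ℚ (Module.End ℚ (Vec N)) where
  carrier := {T | ∀ (f : Vec N) (j : ℕ), (∀ q, wt q < j → f q = 0) →
    ∀ q, wt q < i + j → T f q = 0}
  zero_mem' := fun _ _ _ _ _ => rfl
  add_mem' {S T} hS hT := fun f j hf q hq => by
    rw [LinearMap.add_apply, Pi.add_apply, hS f j hf q hq, hT f j hf q hq, add_zero]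
  smul_mem' c T hT := fun f j hf q hq => by
    rw [LinearMap.smul_apply, Pi.smul_apply, hT f j hf q hq, smul_zero]

section

variable {N : ℕ} (wt : Fin (N + 1) × Fin 3 → ℕ)

theorem filt_mul (i j : ℕ) (S T : Module.End ℚ (Vec N)) (hS : S ∈ filt wt i)
    (hT : T ∈ filt wt j) : S * T ∈ filt wt (i + j) := fun f k hf q hq =>
  hS (T f) (j + k) (hT f k hf) q (by omega)

theorem filt_antitone : Antitone (filt wt) := fun _ _ hij _ hT f k hf q hq =>
  hT f k hf q (by omega)

theorem filt_eq_bot {n : ℕ} (h : ∀ q, wt q < n) : filt wt n = ⊥ := by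
  rw [eq_bot_iff]
  intro T hT
  rw [Submodule.mem_bot]
  exact LinearMap.ext fun f => funext fun q => hT f 0 (by simp) q (h q)

theorem rep_pow_eq_zero {n : ℕ} (h : ∀ q, wt q < n + 1) {T : Module.End ℚ (Vec N)}
    (hT : T ∈ filt wt 1) : T ^ (n + 1) = 0 :=
  BCH.pow_eq_zero_of_mem (filt_mul wt) (filt_eq_bot wt h) hT

end

/-- The total degree of an exponent. -/
def wtDeg {N : ℕ} (q : Fin (N + 1) × Fin 3) : ℕ := q.1 + q.2

/-- The degree in `y` of an exponent. -/
def wtLevel {N : ℕ} (q : Fin (N + 1) × Fin 3) : ℕ := q.2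

theorem wtDeg_lt {N : ℕ} (q : Fin (N + 1) × Fin 3) : wtDeg q < N + 2 + 1 := by
  have h1 := q.1.2
  have h2 := q.2.2
  simp only [wtDeg]
  omega

theorem wtLevel_lt {N : ℕ} (q : Fin (N + 1) × Fin 3) : wtLevel q < 2 + 1 := q.2.2

theorem monoOp_mem_filt_deg (N : ℕ) (p : NPlus) : monoOp N p ∈ filt wtDeg 1 := by
  intro f j hf q hq
  rw [monoOp_apply]
  split_ifs with h
  · rw [hf, mul_zero]
    have := p.pos
    simp only [wtDeg] at hq ⊢
    omega
  · rfl

theorem monoOp_mem_filt_level (N : ℕ) (p : NPlus) (hp : 0 < p.b) :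
    monoOp N p ∈ filt wtLevel 1 := by
  intro f j hf q hq
  rw [monoOp_apply]
  split_ifs with h
  · rw [hf, mul_zero]
    simp only [wtLevel] at hq ⊢
    omega
  · rfl

theorem rep_mem_filt_deg (N : ℕ) (x : GradedLie) : rep N x ∈ filt wtDeg 1 := by
  have := eq_top_of_X_mem ((filt wtDeg 1).comap (rep N)) fun p => by
    rw [Submodule.mem_comap, rep_X]; exact monoOp_mem_filt_deg N p
  exact (this ▸ Submodule.mem_top : x ∈ (filt wtDeg 1).comap (rep N))

theorem rep_nilpotent (N : ℕ) (x : GradedLie) : IsNilpotent (rep N x) :=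
  ⟨_, rep_pow_eq_zero wtDeg wtDeg_lt (rep_mem_filt_deg N x)⟩

theorem monoOp_eq_zero {N : ℕ} {p : NPlus} (h : N < p.a ∨ 2 < p.b) : monoOp N p = 0 := by
  refine LinearMap.ext fun f => funext fun q => ?_
  have h1 := q.1.2
  have h2 := q.2.2
  rw [monoOp_apply, if_neg (by omega)]
  rfl

theorem rep_eq_zero_of_mem {N : ℕ} {x : GradedLie} (hx : x ∈ gtSubmodule (N + 2)) :
    rep N x = 0 := by
  have : gtSubmodule (N + 2) ≤ LinearMap.ker (rep N) := by
    refine Submodule.span_le.2 ?_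
    rintro _ ⟨p, hp, rfl⟩
    rw [SetLike.mem_coe, LinearMap.mem_ker, rep_X]
    refine monoOp_eq_zero ?_
    have : N + 2 < p.a + p.b := hp
    omega
  exact this hx

/-- The coefficients of an element of positive level can be read off from its action on `x`. -/
theorem rep_apply_single {N k b : ℕ} (hk : k + 1 < N + 1) (hb : b < 3) (hb0 : 0 < b)
    (x : GradedLie) :
    rep N x (Pi.single (⟨1, by omega⟩, ⟨0, by omega⟩) 1) (⟨k + 1, hk⟩, ⟨b, hb⟩) =
      b * coeff ⟨k, b, by omega⟩ x := by
  have : (LinearMap.proj ((⟨k + 1, hk⟩, ⟨b, hb⟩) : Fin (N + 1) × Fin 3)).comp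
      ((LinearMap.applyₗ (R := ℚ) (Pi.single (⟨1, by omega⟩, ⟨0, by omega⟩) 1 : Vec N)).comp
        (rep N)) = (b : ℚ) • coeff ⟨k, b, by omega⟩ := by
    refine hom_ext fun p => ?_
    simp only [LinearMap.comp_apply, LinearMap.proj_apply, LinearMap.applyₗ_apply_apply,
      LinearMap.smul_apply, coeff_X, rep_X, monoOp_apply, smul_eq_mul, Pi.single_apply,
      Prod.mk.injEq, Fin.mk.injEq, NPlus.ext_iff]
    by_cases h : p.a = k ∧ p.b = b
    · rw [if_pos h, if_pos (by omega), if_pos (by omega), h.1, h.2]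
      push_cast
      ring
    · rw [if_neg h, mul_zero]
      split_ifs
      · omega
      · exact mul_zero _
      · rfl
  exact LinearMap.congr_fun this x

/-- The representation of the quotient `𝔤^{≤ N + 2}`. -/
noncomputable def repLe (N : ℕ) : Le (N + 2) →ₗ⁅ℚ⁆ Module.End ℚ (Vec N) where
  __ := Submodule.liftQ (gtSubmodule (N + 2)) (rep N) fun _ hx => rep_eq_zero_of_mem hx
  map_lie' {x y} := by
    obtain ⟨x, rfl⟩ := toLe_surjective _ x
    obtain ⟨y, rfl⟩ := toLe_surjective _ y
    exact rep_lie N x y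

theorem repLe_toLe (N : ℕ) (x : GradedLie) : repLe N (toLe (N + 2) x) = rep N x := rfl

/-- The operator by which an element of the group acts. -/
noncomputable def groupRep (N : ℕ) (g : GroupLe (N + 2)) : Module.End ℚ (Vec N) :=
  IsNilpotent.exp (repLe N g.log)

theorem groupRep_mul (N : ℕ) (g h : GroupLe (N + 2)) :
    groupRep N (g * h) = groupRep N g * groupRep N h := by
  obtain ⟨x, hx⟩ := toLe_surjective _ g.log
  obtain ⟨y, hy⟩ := toLe_surjective _ h.log
  show IsNilpotent.exp (repLe N (BCH.bch (N + 2) g.log h.log)) = _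
  rw [BCH.map_bch, groupRep, groupRep, ← hx, ← hy, repLe_toLe, repLe_toLe]
  exact (BCH.exp_mul_exp_eq_exp_bch (filt_mul wtDeg) (filt_antitone wtDeg)
    (filt_eq_bot wtDeg wtDeg_lt) (rep_mem_filt_deg N x) (rep_mem_filt_deg N y)).symm

theorem groupRep_one (N : ℕ) : groupRep N 1 = 1 := by
  show IsNilpotent.exp (repLe N 0) = 1
  rw [map_zero, IsNilpotent.exp_zero]

theorem groupRep_list_prod (N : ℕ) (t : List (GroupLe (N + 2))) :
    groupRep N t.prod = (t.map (groupRep N)).prod := by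
  induction t with
  | nil => exact groupRep_one N
  | cons g t ih => rw [List.prod_cons, groupRep_mul, ih, List.map_cons, List.prod_cons]

end PoissonRep

/-! ### The part of level zero -/

namespace GradedLie

/-- The logarithm of `Ψ[p]`, truncated after `l` terms. -/
noncomputable def psi (l : ℕ) (p : NPlus) : GradedLie :=
  ∑ i ∈ Finset.range l, ((-1 : ℚ) ^ (i + 2) / ((i : ℚ) + 1) ^ 2) • X (NPlus.succMul i p)

theorem mem_gtSubmodule_of_coeff_eq_zero {l : ℕ} {x : GradedLie}
    (h : ∀ p : NPlus, p.deg ≤ l → coeff p x = 0) : x ∈ gtSubmodule l := by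
  induction l with
  | zero => rw [gtSubmodule_zero]; trivial
  | succ l ih =>
    have h1 := sub_homogeneous_mem (ih fun p hp => h p (by omega))
    rwa [homogeneous, Finset.sum_eq_zero, sub_zero] at h1
    intro p hp
    rw [h p (by have := (Finset.mem_filter.1 hp).2; omega), zero_smul]

/-- The form vanishes on pairs of level zero, so no bracket has a component of level zero. -/
theorem coeff_lie_eq_zero {p : NPlus} (hp : p.b = 0) (x y : GradedLie) : coeff p ⁅x, y⁆ = 0 := by
  have h1 : ∀ q y, coeff p ⁅X q, y⁆ = 0 := by
    intro q y
    have : (coeff p).comp (lieMap (X q)) = 0 := by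
      refine hom_ext fun r => ?_
      rw [LinearMap.comp_apply, lieMap_X, map_smul, coeff_X]
      split_ifs with h
      · have h2 : q.b + r.b = 0 := by rw [← NPlus.add_b, h, hp]
        have h3 : q.b = 0 := by omega
        have h4 : r.b = 0 := by omega
        simp [NPlus.form, h3, h4]
      · simp
    exact LinearMap.congr_fun this y
  have : (coeff p).comp (lieMap.flip y) = 0 := hom_ext fun q => h1 q y
  exact LinearMap.congr_fun this x

/-- The span of the `X_p` of level zero. -/
noncomputable def levelZero : Submodule ℚ GradedLie := Submodule.span ℚ (X '' {p | p.b = 0})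

theorem lie_eq_zero_of_mem_levelZero {x y : GradedLie} (hx : x ∈ levelZero) (hy : y ∈ levelZero) :
    ⁅x, y⁆ = 0 := by
  induction hx using Submodule.span_induction with
  | zero => exact zero_lie y
  | add x x' _ _ h h' => rw [add_lie, h, h', add_zero]
  | smul c x _ h => rw [smul_lie, h, smul_zero]
  | mem x hx =>
    obtain ⟨p, hp, rfl⟩ := hx
    have hp : p.b = 0 := hp
    induction hy using Submodule.span_induction with
    | zero => exact lie_zero _
    | add x x' _ _ h h' => rw [lie_add, h, h', add_zero]
    | smul c x _ h => rw [lie_smul, h, smul_zero]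
    | mem y hy =>
      obtain ⟨q, hq, rfl⟩ := hy
      have hq : q.b = 0 := hq
      rw [lie_X]
      simp [NPlus.form, hp, hq]

theorem psi_mem_levelZero (l : ℕ) {p : NPlus} (hp : p.b = 0) : psi l p ∈ levelZero :=
  sum_mem fun i _ => Submodule.smul_mem _ _
    (Submodule.subset_span ⟨_, by simp [NPlus.succMul, hp], rfl⟩)

theorem coeff_psi (l : ℕ) (p q : NPlus) : coeff q (psi l p) =
    ∑ i ∈ Finset.range l, if NPlus.succMul i p = q then (-1 : ℚ) ^ (i + 2) / ((i : ℚ) + 1) ^ 2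
      else 0 := by
  simp [psi, coeff_X]

theorem coeff_psi_eq_zero (l : ℕ) {p q : NPlus} (hp : 0 < p.b) (hq : q.b = 0) :
    coeff q (psi l p) = 0 := by
  rw [coeff_psi]
  refine Finset.sum_eq_zero fun i _ => if_neg ?_
  rintro rfl
  exact (Nat.mul_pos (Nat.succ_pos i) hp).ne' hq

theorem coeff_psi_eq_zero' (l : ℕ) {p q : NPlus} (hp : p.b = 0) (hq : 0 < q.b) :
    coeff q (psi l p) = 0 := by
  rw [coeff_psi]
  refine Finset.sum_eq_zero fun i _ => if_neg ?_
  rintro rfl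
  simp [NPlus.succMul, hp] at hq

attribute [local instance] LieRing.ofAssociativeRing in
/-- The coefficient of `X_p` with `p` of level zero vanishes on brackets, hence is a homomorphism to
the abelian Lie algebra `ℚ`. -/
noncomputable def coeffLe {l : ℕ} {p : NPlus} (hp : p.b = 0) (hl : p.deg ≤ l) : Le l →ₗ⁅ℚ⁆ ℚ where
  __ := Submodule.liftQ (gtSubmodule l) (coeff p) fun _ hx => coeff_eq_zero_of_mem hx hl
  map_lie' {x y} := by
    obtain ⟨x, rfl⟩ := toLe_surjective _ x
    obtain ⟨y, rfl⟩ := toLe_surjective _ y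
    refine (coeff_lie_eq_zero hp x y).trans ?_
    rw [Ring.lie_def, mul_comm, sub_self]

attribute [local instance] LieRing.ofAssociativeRing in
theorem coeffLe_log_mul {l : ℕ} {p : NPlus} (hp : p.b = 0) (hl : p.deg ≤ l) (g h : GroupLe l) :
    coeffLe hp hl (g * h).log = coeffLe hp hl g.log + coeffLe hp hl h.log := by
  have h1 : 1 ≤ l := p.deg_pos.trans_le hl
  have hab : ∀ z c : ℚ, ⁅z, c⁆ = 0 := fun z c => by rw [Ring.lie_def, mul_comm, sub_self]
  have h2 := BCH.bch_add_central h1 (0 : ℚ) 0 (hab (coeffLe hp hl g.log))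
    (hab (coeffLe hp hl h.log))
  rw [zero_add, zero_add, BCH.bch_zero_left h1, zero_add] at h2
  exact (BCH.map_bch (coeffLe hp hl) l g.log h.log).trans h2

theorem coeffLe_log_list_prod {l : ℕ} {p : NPlus} (hp : p.b = 0) (hl : p.deg ≤ l)
    (t : List (GroupLe l)) :
    coeffLe hp hl t.prod.log = (t.map fun g => coeffLe hp hl g.log).sum := by
  induction t with
  | nil => exact map_zero (coeffLe hp hl)
  | cons g t ih => rw [List.prod_cons, coeffLe_log_mul, ih, List.map_cons, List.sum_cons]

/-- The sum of the brackets of all pairs of entries, in the order of the list. -/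
noncomputable def pairLie (f : NPlus → GradedLie) : List NPlus → GradedLie
  | [] => 0
  | p :: t => (t.map fun q => ⁅f p, f q⁆).sum + pairLie f t

/-- The truncated logarithm of `Ψ[p] ^ u p` if `p` has level zero, and `0` otherwise. -/
noncomputable def zeroPart (l : ℕ) (u : NPlus → ℚ) (p : NPlus) : GradedLie :=
  if p.b = 0 then u p • psi l p else 0

/-- The truncated logarithm of `Ψ[p] ^ u p` if `p` has positive level, and `0` otherwise. -/
noncomputable def positivePart (l : ℕ) (u : NPlus → ℚ) (p : NPlus) : GradedLie :=
  if p.b = 0 then 0 else u p • psi l p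

theorem zeroPart_mem_levelZero (l : ℕ) (u : NPlus → ℚ) (p : NPlus) :
    zeroPart l u p ∈ levelZero := by
  rw [zeroPart]
  split_ifs with h
  · exact Submodule.smul_mem _ _ (psi_mem_levelZero l h)
  · exact zero_mem _

theorem sum_zeroPart_mem_levelZero (l : ℕ) (u : NPlus → ℚ) (t : List NPlus) :
    (t.map (zeroPart l u)).sum ∈ levelZero := by
  refine list_sum_mem fun x hx => ?_
  obtain ⟨p, -, rfl⟩ := List.mem_map.1 hx
  exact zeroPart_mem_levelZero l u p

end GradedLie

namespace NPlus

/-- In the order on `N⁺`, elements of level zero precede those of positive level. -/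
theorem b_pos_of_le {p q : NPlus} (h : p ≤ q) (hp : 0 < p.b) : 0 < q.b := by
  rw [le_iff] at h
  by_contra hq
  have hq0 : q.b = 0 := by omega
  have hqa : 0 < q.a := by have := q.pos; omega
  have h1 : (0 : ℤ) < p.b * q.a := by positivity
  have h2 : form p q = p.b * q.a := by simp [form, hq0]
  omega

end NPlus

/-! ### Products of exponentials in the representation -/

namespace PoissonRep

open GradedLie

attribute [local instance] LieRing.ofAssociativeRing

variable {N : ℕ}

/-- Operators of positive level generate a two-step nilpotent algebra, where the
Baker-Campbell-Hausdorff series stops at the first bracket. -/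
theorem exp_mul_exp_of_level {S T : Module.End ℚ (Vec N)} (hS : S ∈ filt wtLevel 1)
    (hT : T ∈ filt wtLevel 1) :
    IsNilpotent.exp S * IsNilpotent.exp T =
      IsNilpotent.exp (S + T + (2⁻¹ : ℚ) • ⁅S, T⁆) := by
  have hbot : ∀ i, 3 ≤ i → ∀ R ∈ filt (N := N) wtLevel i, R = 0 := by
    intro i hi R hR
    have := filt_antitone wtLevel hi hR
    rwa [filt_eq_bot wtLevel wtLevel_lt, Submodule.mem_bot] at this
  have hL : ⁅S, T⁆ ∈ filt (N := N) wtLevel 2 := by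
    rw [Ring.lie_def]
    exact sub_mem (filt_mul wtLevel 1 1 _ _ hS hT) (filt_mul wtLevel 1 1 _ _ hT hS)
  have hsum : S + T ∈ filt (N := N) wtLevel 1 := add_mem hS hT
  have hU : S + T + (2⁻¹ : ℚ) • ⁅S, T⁆ ∈ filt (N := N) wtLevel 1 :=
    add_mem hsum (filt_antitone wtLevel (by omega) (Submodule.smul_mem _ _ hL))
  have hexp : ∀ R ∈ filt (N := N) wtLevel 1,
      IsNilpotent.exp R = 1 + R + (2⁻¹ : ℚ) • (R * R) := by
    intro R hR
    rw [IsNilpotent.exp_eq_sum (rep_pow_eq_zero wtLevel wtLevel_lt hR), Finset.sum_range_succ,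
      Finset.sum_range_succ, Finset.sum_range_one]
    simp [pow_two]
  have hsq : (S + T + (2⁻¹ : ℚ) • ⁅S, T⁆) * (S + T + (2⁻¹ : ℚ) • ⁅S, T⁆) =
      S * S + S * T + T * S + T * T := by
    have h1 := hbot 3 le_rfl _ (filt_mul wtLevel 1 2 _ _ hsum hL)
    have h2 := hbot 3 le_rfl _ (filt_mul wtLevel 2 1 _ _ hL hsum)
    have h3 := hbot 4 (by omega) _ (filt_mul wtLevel 2 2 _ _ hL hL)
    rw [add_mul _ ((2⁻¹ : ℚ) • ⁅S, T⁆), mul_add _ _ ((2⁻¹ : ℚ) • ⁅S, T⁆),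
      mul_add _ _ ((2⁻¹ : ℚ) • ⁅S, T⁆), mul_smul_comm, smul_mul_assoc, smul_mul_assoc,
      mul_smul_comm, h1, h2, h3]
    simp only [smul_zero, add_zero]
    noncomm_ring
  have hST := filt_mul wtLevel 1 1 _ _ hS hT
  have hSS := filt_mul wtLevel 1 1 _ _ hS hS
  have hTT := filt_mul wtLevel 1 1 _ _ hT hT
  have e1 : S * (T * T) = 0 := hbot 3 le_rfl _ (filt_mul wtLevel 1 2 _ _ hS hTT)
  have e2 : S * S * T = 0 := hbot 3 le_rfl _ (filt_mul wtLevel 2 1 _ _ hSS hT)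
  have e3 : S * S * (T * T) = 0 := hbot 4 (by omega) _ (filt_mul wtLevel 2 2 _ _ hSS hTT)
  rw [hexp S hS, hexp T hT, hexp _ hU, hsq, Ring.lie_def]
  simp only [add_mul, mul_add, one_mul, mul_one, smul_mul_assoc, mul_smul_comm, e1, e2, e3,
    smul_zero, add_zero]
  module

theorem rep_positivePart_mem (l : ℕ) (u : NPlus → ℚ) (p : NPlus) :
    rep N (positivePart l u p) ∈ filt wtLevel 1 := by
  rw [positivePart]
  split_ifs with h
  · rw [map_zero]; exact zero_mem _
  · rw [map_smul, psi, map_sum]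
    refine Submodule.smul_mem _ _ (sum_mem fun i _ => ?_)
    rw [map_smul, rep_X]
    refine Submodule.smul_mem _ _ (monoOp_mem_filt_level N _ ?_)
    exact Nat.mul_pos (Nat.succ_pos i) (Nat.pos_of_ne_zero h)

theorem rep_sum_positivePart_mem (l : ℕ) (u : NPlus → ℚ) (t : List NPlus) :
    rep N (t.map (positivePart l u)).sum ∈ filt wtLevel 1 := by
  rw [map_list_sum]
  refine list_sum_mem fun x hx => ?_
  obtain ⟨_, hy, rfl⟩ := List.mem_map.1 hx
  obtain ⟨p, -, rfl⟩ := List.mem_map.1 hy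
  exact rep_positivePart_mem l u p

theorem rep_pairLie_mem (l : ℕ) (u : NPlus → ℚ) (t : List NPlus) :
    rep N (pairLie (positivePart l u) t) ∈ filt wtLevel 2 := by
  induction t with
  | nil => rw [pairLie, map_zero]; exact zero_mem _
  | cons p t ih =>
    rw [pairLie, map_add, map_list_sum]
    refine add_mem (list_sum_mem fun x hx => ?_) ih
    obtain ⟨_, hy, rfl⟩ := List.mem_map.1 hx
    obtain ⟨q, -, rfl⟩ := List.mem_map.1 hy
    have h1 := rep_positivePart_mem (N := N) l u p
    have h2 := rep_positivePart_mem (N := N) l u q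
    rw [rep_lie, Ring.lie_def]
    exact sub_mem (filt_mul wtLevel 1 1 _ _ h1 h2) (filt_mul wtLevel 1 1 _ _ h2 h1)

theorem sum_map_lie (x : GradedLie) (f : NPlus → GradedLie) (t : List NPlus) :
    (t.map fun q => ⁅x, f q⁆).sum = ⁅x, (t.map f).sum⁆ := by
  induction t with
  | nil => exact (lie_zero x).symm
  | cons q t ih => rw [List.map_cons, List.sum_cons, ih, List.map_cons, List.sum_cons, lie_add]

/-- In an ordered product the factors of level zero come first; the remaining ones combine into one
exponential. -/
theorem prod_exp_rep (l : ℕ) (u : NPlus → ℚ) (t : List NPlus) (ht : t.Pairwise (· ≤ ·)) :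
    (t.map fun p => IsNilpotent.exp (rep N (u p • psi l p))).prod =
      IsNilpotent.exp (rep N (t.map (zeroPart l u)).sum) *
      IsNilpotent.exp (rep N ((t.map (positivePart l u)).sum +
        (2⁻¹ : ℚ) • pairLie (positivePart l u) t)) := by
  induction t with
  | nil => simp [pairLie]
  | cons p t ih =>
    obtain ⟨hp, ht⟩ := List.pairwise_cons.1 ht
    rw [List.map_cons, List.prod_cons, ih ht, List.map_cons, List.sum_cons, List.map_cons,
      List.sum_cons, pairLie, sum_map_lie]
    by_cases h0 : p.b = 0
    · have h1 : zeroPart l u p = u p • psi l p := if_pos h0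
      have h2 : positivePart l u p = 0 := if_pos h0
      rw [h2, zero_lie, zero_add, zero_add, ← h1, ← mul_assoc,
        map_add (rep N) (zeroPart l u p),
        IsNilpotent.exp_add_of_commute _ (rep_nilpotent N _) (rep_nilpotent N _)]
      rw [commute_iff_lie_eq, ← rep_lie, lie_eq_zero_of_mem_levelZero
        (zeroPart_mem_levelZero l u p) (sum_zeroPart_mem_levelZero l u t), map_zero]
    · have h1 : zeroPart l u p = 0 := if_neg h0
      have h2 : positivePart l u p = u p • psi l p := if_neg h0
      have h3 : (t.map (zeroPart l u)).sum = 0 := by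
        refine List.sum_eq_zero fun x hx => ?_
        obtain ⟨q, hq, rfl⟩ := List.mem_map.1 hx
        exact if_neg (NPlus.b_pos_of_le (hp q hq) (Nat.pos_of_ne_zero h0)).ne'
      have h4 := rep_pairLie_mem (N := N) l u t
      have h5 := rep_positivePart_mem (N := N) l u p
      have h6 : ⁅rep N (positivePart l u p),
          (2⁻¹ : ℚ) • rep N (pairLie (positivePart l u) t)⁆ = 0 := by
        have h7 : ∀ R ∈ filt (N := N) wtLevel 3, R = 0 := fun R hR => by
          rwa [filt_eq_bot wtLevel wtLevel_lt, Submodule.mem_bot] at hR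
        rw [Ring.lie_def, mul_smul_comm, smul_mul_assoc, h7 _ (filt_mul wtLevel 1 2 _ _ h5 h4),
          h7 _ (filt_mul wtLevel 2 1 _ _ h4 h5), smul_zero, sub_self]
      rw [h1, h3, zero_add, map_zero, IsNilpotent.exp_zero, one_mul, one_mul, ← h2,
        exp_mul_exp_of_level h5]
      · congr 1
        simp only [map_add, map_smul, rep_lie, lie_add, h6, add_zero, smul_add]
        abel
      · rw [map_add, map_smul]
        exact add_mem (rep_sum_positivePart_mem l u t)
          (Submodule.smul_mem _ _ (filt_antitone wtLevel (by omega) h4))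

end PoissonRep

/-! ### Conjugation by the level-zero part -/

namespace PoissonRep

open GradedLie hiding X
open Polynomial NilpotentExpLog

attribute [local instance] LieRing.ofAssociativeRing

variable {N : ℕ}

theorem exp_conj {A : Type*} [Ring A] [Algebra ℚ A] {e e' y : A} (h : e * e' = 1) (h' : e' * e = 1)
    (hy : IsNilpotent y) : IsNilpotent.exp (e' * y * e) = e' * IsNilpotent.exp y * e := by
  have hpow : ∀ k, (e' * y * e) ^ k = e' * y ^ k * e := by
    intro k
    induction k with
    | zero => simp [h']
    | succ k ih =>
      rw [pow_succ, ih, pow_succ]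
      calc e' * y ^ k * e * (e' * y * e) = e' * y ^ k * (e * e') * y * e := by noncomm_ring
        _ = _ := by rw [h]; noncomm_ring
  obtain ⟨k, hk⟩ := hy
  have hk' : (e' * y * e) ^ k = 0 := by rw [hpow, hk, mul_zero, zero_mul]
  rw [IsNilpotent.exp_eq_sum hk, IsNilpotent.exp_eq_sum hk', Finset.mul_sum, Finset.sum_mul]
  refine Finset.sum_congr rfl fun i _ => ?_
  rw [hpow, mul_smul_comm, smul_mul_assoc]

/-- The polynomials in `x` embedded as the elements of level `b`, with `xᵏ` mapped to
`X_(k, b)`. -/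
noncomputable def levelMap (N b : ℕ) (hb : 0 < b) : ℚ[X] →ₗ[ℚ] Module.End ℚ (Vec N) :=
  (Polynomial.basisMonomials ℚ).constr ℚ fun k => rep N (GradedLie.X ⟨k, b, by omega⟩)

theorem levelMap_X_pow (b : ℕ) (hb : 0 < b) (k : ℕ) :
    levelMap N b hb (X ^ k) = rep N (GradedLie.X ⟨k, b, by omega⟩) := by
  have h := (Polynomial.basisMonomials ℚ).constr_basis ℚ
    (fun k => rep N (GradedLie.X ⟨k, b, by omega⟩)) k
  rw [Polynomial.coe_basisMonomials] at h
  rw [X_pow_eq_monomial]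
  exact h

theorem levelMap_eq_zero_of_dvd (b : ℕ) (hb : 0 < b) {n : ℕ} (hn : N < n) {p : ℚ[X]}
    (h : X ^ n ∣ p) : levelMap N b hb p = 0 := by
  obtain ⟨r, rfl⟩ := h
  induction r using Polynomial.induction_on' with
  | add p q hp hq => rw [mul_add, map_add, hp, hq, add_zero]
  | monomial k a =>
    rw [← C_mul_X_pow_eq_monomial, mul_left_comm, ← pow_add, ← smul_eq_C_mul, map_smul,
      levelMap_X_pow, rep_X, monoOp_eq_zero (Or.inl (by simp only; omega)), smul_zero]

/-- On level `b`, the adjoint action of `- m log Ψ[(1, 0)]` is multiplication by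
`b m log (1 + x)`. -/
theorem ad_levelMap (m b : ℕ) (hb : 0 < b) {K : ℕ} (hK : N + 2 ≤ K) (p : ℚ[X]) :
    ⁅rep N (-(m : ℚ) • psi (N + 2) ⟨1, 0, by norm_num⟩), levelMap N b hb p⁆ =
      levelMap N b hb (p * (C ((b * m : ℕ) : ℚ) * logPoly K)) := by
  induction p using Polynomial.induction_on' with
  | add p q hp hq => rw [map_add, lie_add, hp, hq, add_mul, map_add]
  | monomial k a =>
    rw [← C_mul_X_pow_eq_monomial, ← smul_eq_C_mul, map_smul (levelMap N b hb), smul_mul_assoc,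
      map_smul (levelMap N b hb)]
    have hsm : ∀ S T : Module.End ℚ (Vec N), ⁅S, a • T⁆ = a • ⁅S, T⁆ := fun S T => by
      rw [Ring.lie_def, Ring.lie_def, mul_smul_comm, smul_mul_assoc, smul_sub]
    rw [hsm]
    congr 1
    rw [levelMap_X_pow, ← rep_lie, psi, Finset.smul_sum, sum_lie, map_sum]
    have h1 : X ^ k * (C ((b * m : ℕ) : ℚ) * logPoly K) = ∑ i ∈ Finset.range K,
        ((b * m : ℕ) * ((-1 : ℚ) ^ i / (i + 1))) • X ^ (k + i + 1) := by
      rw [logPoly, logDiv, Finset.mul_sum, Finset.mul_sum, Finset.mul_sum]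
      refine Finset.sum_congr rfl fun i _ => ?_
      rw [smul_eq_C_mul, C_mul]
      ring
    rw [h1, map_sum]
    have h2 : ∑ i ∈ Finset.range K, levelMap N b hb
        (((b * m : ℕ) * ((-1 : ℚ) ^ i / (i + 1))) • X ^ (k + i + 1)) =
        ∑ i ∈ Finset.range (N + 2), levelMap N b hb
        (((b * m : ℕ) * ((-1 : ℚ) ^ i / (i + 1))) • X ^ (k + i + 1)) := by
      symm
      refine Finset.sum_subset (Finset.range_mono hK) fun i _ hi => ?_
      rw [Finset.mem_range] at hi
      rw [map_smul, levelMap_eq_zero_of_dvd b hb (n := k + i + 1) (by omega) dvd_rfl, smul_zero]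
    rw [h2]
    refine Finset.sum_congr rfl fun i _ => ?_
    rw [map_smul, levelMap_X_pow, smul_lie, smul_lie, lie_X, smul_smul, smul_smul, map_smul]
    have h3 : NPlus.succMul i ⟨1, 0, by norm_num⟩ + ⟨k, b, by omega⟩ =
        ⟨k + i + 1, b, by omega⟩ := by
      ext <;> simp [NPlus.succMul]; omega
    rw [h3]
    congr 1
    simp only [NPlus.form, NPlus.succMul]
    push_cast
    have : (i : ℚ) + 1 ≠ 0 := by positivity
    field_simp
    ring

/-- Conjugation by `Ψ[(1, 0)] ^ m` multiplies level `b` by `(1 + x) ^ (b m)`. -/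
theorem exp_ad_levelMap (m b : ℕ) (hb : 0 < b) (p : ℚ[X]) :
    IsNilpotent.exp (LieAlgebra.ad ℚ (Module.End ℚ (Vec N))
      (rep N (-(m : ℚ) • psi (N + 2) ⟨1, 0, by norm_num⟩))) (levelMap N b hb p) =
    levelMap N b hb (p * (1 + X) ^ (b * m)) := by
  obtain ⟨k, hk⟩ := LieAlgebra.ad_nilpotent_of_nilpotent (R := ℚ)
    (rep_nilpotent N (-(m : ℚ) • psi (N + 2) ⟨1, 0, by norm_num⟩))
  set K := k + N + 2 with hK
  set T := LieAlgebra.ad ℚ (Module.End ℚ (Vec N))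
      (rep N (-(m : ℚ) • psi (N + 2) ⟨1, 0, by norm_num⟩)) with hT
  set Q := C ((b * m : ℕ) : ℚ) * logPoly K with hQ
  have hpow : ∀ i, (T ^ i) (levelMap N b hb p) = levelMap N b hb (p * Q ^ i) := by
    intro i
    induction i with
    | zero => simp
    | succ i ih =>
      rw [pow_succ', Module.End.mul_apply, ih, hT, LieAlgebra.ad_apply,
        ad_levelMap m b hb (show N + 2 ≤ K by omega), pow_succ, mul_assoc]
  have h1 : IsNilpotent.exp T (levelMap N b hb p) =
      levelMap N b hb (p * (expPoly (K + 1)).comp Q) := by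
    rw [IsNilpotent.exp_eq_sum (pow_eq_zero_of_le (show k ≤ K + 1 by omega) hk),
      LinearMap.sum_apply, expPoly, Polynomial.sum_comp, Finset.mul_sum, map_sum]
    refine Finset.sum_congr rfl fun i _ => ?_
    rw [LinearMap.smul_apply, hpow, mul_comp, C_comp, X_pow_comp, mul_left_comm, ← smul_eq_C_mul,
      map_smul]
  have h2 := X_pow_dvd_expPoly_comp_logPoly (b * m) K
  rw [h1, ← sub_eq_zero, ← map_sub, ← mul_sub]
  exact levelMap_eq_zero_of_dvd b hb (by omega) (h2.mul_left p)

/-- The truncated logarithm of the conjugate `Ψ[(1, 0)] ^ (-m) * Ψ[(0, 1)] ^ n * Ψ[(1, 0)] ^ m`: on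
level `j + 1` it is the coefficient of `Ψ[(0, 1)] ^ n` times `(1 + x) ^ ((j + 1) m)`. -/
noncomputable def conjPsi (l m n : ℕ) : GradedLie :=
  (n : ℚ) • ∑ j ∈ Finset.range l, ((-1 : ℚ) ^ (j + 2) / ((j : ℚ) + 1) ^ 2) •
    ∑ k ∈ Finset.range ((j + 1) * m + 1), ((((j + 1) * m).choose k : ℕ) : ℚ) •
      GradedLie.X ⟨k, j + 1, by omega⟩

theorem rep_conjPsi (m n : ℕ) :
    IsNilpotent.exp (-rep N ((m : ℚ) • psi (N + 2) ⟨1, 0, by norm_num⟩)) *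
      rep N ((n : ℚ) • psi (N + 2) ⟨0, 1, by norm_num⟩) *
      IsNilpotent.exp (rep N ((m : ℚ) • psi (N + 2) ⟨1, 0, by norm_num⟩)) =
      rep N (conjPsi (N + 2) m n) := by
  have h := exp_ad_apply (rep_nilpotent N (-(m : ℚ) • psi (N + 2) ⟨1, 0, by norm_num⟩))
    (rep N ((n : ℚ) • psi (N + 2) ⟨0, 1, by norm_num⟩))
  rw [neg_smul, map_neg, neg_neg] at h
  rw [← h, ← map_neg, ← neg_smul]
  obtain ⟨T, hT⟩ : ∃ T, T = IsNilpotent.exp (LieAlgebra.ad ℚ (Module.End ℚ (Vec N))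
    (rep N (-(m : ℚ) • psi (N + 2) ⟨1, 0, by norm_num⟩))) := ⟨_, rfl⟩
  rw [← hT, conjPsi, psi]
  simp only [map_smul, map_sum]
  congr 1
  refine Finset.sum_congr rfl fun j _ => ?_
  congr 1
  have h1 : NPlus.succMul j ⟨0, 1, by norm_num⟩ = ⟨0, j + 1, by omega⟩ := by
    ext <;> simp [NPlus.succMul]
  have h2 := exp_ad_levelMap (N := N) m (j + 1) (Nat.succ_pos j) 1
  rw [show (1 : ℚ[X]) = X ^ 0 from (pow_zero X).symm, levelMap_X_pow, pow_zero, one_mul, ← hT] at h2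
  rw [h1]
  refine h2.trans ?_
  rw [add_comm (1 : ℚ[X]) X, add_pow, map_sum]
  refine Finset.sum_congr rfl fun k _ => ?_
  rw [one_pow, mul_one, mul_comm, ← C_eq_natCast, ← smul_eq_C_mul, map_smul, levelMap_X_pow]

/-! ### The equation for the exponents -/

/-- The level-zero parts of both sides of the factorization agree. -/
theorem rep_sum_zeroPart {m n : ℕ} {u : NPlus → ℚ}
    (hu : StructureGroup.IsOrderedExponents m n u) :
    rep N (((NPlus.degLE (N + 2)).sort (· ≤ ·)).map (zeroPart (N + 2) u)).sum =
      rep N ((m : ℚ) • psi (N + 2) ⟨1, 0, by norm_num⟩) := by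
  rw [← sub_eq_zero, ← map_sub]
  refine rep_eq_zero_of_mem (mem_gtSubmodule_of_coeff_eq_zero fun p hp => ?_)
  rw [map_sub, map_smul, map_list_sum, List.map_map, sub_eq_zero]
  by_cases h0 : p.b = 0
  · have h1 := congrArg (fun g : StructureGroup => coeffLe h0 hp (g.π (N + 2)).log) hu
    have h2 : coeffLe h0 hp ((StructureGroup.Ψ ⟨0, 1, by norm_num⟩ ^ (n : ℚ) *
        StructureGroup.Ψ ⟨1, 0, by norm_num⟩ ^ (m : ℚ) : StructureGroup).π (N + 2)).log =
        coeff p ((n : ℚ) • psi (N + 2) ⟨0, 1, by norm_num⟩) +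
        coeff p ((m : ℚ) • psi (N + 2) ⟨1, 0, by norm_num⟩) := coeffLe_log_mul h0 hp _ _
    have h3 : coeffLe h0 hp ((StructureGroup.orderedProd u).π (N + 2)).log =
        ((((NPlus.degLE (N + 2)).sort (· ≤ ·)).map
          fun q => (StructureGroup.Ψ q).π (N + 2) ^ u q).map
          fun g => coeffLe h0 hp g.log).sum := coeffLe_log_list_prod h0 hp _
    rw [h2, h3, List.map_map, map_smul, map_smul, coeff_psi_eq_zero _ (by norm_num) h0, smul_zero,
      zero_add] at h1
    rw [h1]
    congr 1
    refine List.map_congr_left fun q _ => ?_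
    have h4 : coeffLe h0 hp ((StructureGroup.Ψ q).π (N + 2) ^ u q).log =
        coeff p (u q • psi (N + 2) q) := rfl
    rw [Function.comp_apply, Function.comp_apply, h4, zeroPart]
    split_ifs with hq
    · rfl
    · rw [map_zero, map_smul, coeff_psi_eq_zero _ (Nat.pos_of_ne_zero hq) h0, smul_zero]
  · rw [coeff_psi_eq_zero' _ rfl (Nat.pos_of_ne_zero h0), smul_zero]
    refine List.sum_eq_zero fun x hx => ?_
    obtain ⟨q, -, rfl⟩ := List.mem_map.1 hx
    rw [Function.comp_apply, zeroPart]
    split_ifs with hq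
    · rw [map_smul, coeff_psi_eq_zero' _ hq (Nat.pos_of_ne_zero h0), smul_zero]
    · exact map_zero _

/-- The equation for the exponents after cancelling the level-zero factors. -/
theorem rep_sum_positivePart {m n : ℕ} {u : NPlus → ℚ}
    (hu : StructureGroup.IsOrderedExponents m n u) :
    rep N ((((NPlus.degLE (N + 2)).sort (· ≤ ·)).map (positivePart (N + 2) u)).sum +
      (2⁻¹ : ℚ) • pairLie (positivePart (N + 2) u) ((NPlus.degLE (N + 2)).sort (· ≤ ·))) =
      rep N (conjPsi (N + 2) m n) := by
  have h1 := congrArg (fun g : StructureGroup => groupRep N (g.π (N + 2))) hu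
  have h2 : groupRep N ((StructureGroup.Ψ ⟨0, 1, by norm_num⟩ ^ (n : ℚ) *
      StructureGroup.Ψ ⟨1, 0, by norm_num⟩ ^ (m : ℚ) : StructureGroup).π (N + 2)) =
      IsNilpotent.exp (rep N ((n : ℚ) • psi (N + 2) ⟨0, 1, by norm_num⟩)) *
      IsNilpotent.exp (rep N ((m : ℚ) • psi (N + 2) ⟨1, 0, by norm_num⟩)) := groupRep_mul N _ _
  have h3 : groupRep N ((StructureGroup.orderedProd u).π (N + 2)) =
      ((((NPlus.degLE (N + 2)).sort (· ≤ ·)).map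
        fun q => (StructureGroup.Ψ q).π (N + 2) ^ u q).map (groupRep N)).prod :=
    groupRep_list_prod N _
  have h4 : (groupRep N ∘ fun q => (StructureGroup.Ψ q).π (N + 2) ^ u q) =
      fun q => IsNilpotent.exp (rep N (u q • psi (N + 2) q)) := rfl
  rw [h2, h3, List.map_map, h4, prod_exp_rep _ _ _ (Finset.pairwise_sort _ _),
    rep_sum_zeroPart hu] at h1
  have hL := rep_nilpotent N ((m : ℚ) • psi (N + 2) ⟨1, 0, by norm_num⟩)
  refine exp_injective (rep_nilpotent N _) (rep_nilpotent N _) ?_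
  refine (IsNilpotent.isUnit_exp hL).mul_left_cancel ?_
  rw [← h1, ← rep_conjPsi, exp_conj (IsNilpotent.exp_mul_exp_neg_self hL)
    (IsNilpotent.exp_neg_mul_exp_self hL) (rep_nilpotent N _), ← mul_assoc, ← mul_assoc,
    IsNilpotent.exp_mul_exp_neg_self hL, one_mul]

end PoissonRep

/-! ### Coefficients in levels one and two -/

namespace GradedLie

open Finset

theorem succMul_zero (p : NPlus) : NPlus.succMul 0 p = p := by
  ext <;> simp [NPlus.succMul]

theorem coeff_psi_of_level_one {l : ℕ} (hl : 1 ≤ l) (p : NPlus) {q : NPlus} (hq : q.b = 1) :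
    coeff q (psi l p) = if p = q then 1 else 0 := by
  obtain ⟨l, rfl⟩ : ∃ k, l = k + 1 := ⟨l - 1, by omega⟩
  rw [coeff_psi, sum_range_succ', sum_eq_zero, zero_add, succMul_zero]
  · norm_num
  · intro i _
    refine if_neg ?_
    rintro rfl
    have h : (i + 1 + 1) * p.b = 1 := hq
    have := Nat.dvd_one.1 ⟨p.b, h.symm⟩
    omega

theorem coeff_psi_of_level_two {l : ℕ} (hl : 2 ≤ l) {p q : NPlus} (hp : 0 < p.b) (hq : q.b = 2) :
    coeff q (psi l p) = (if p = q then 1 else 0) +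
      if p.b = 1 ∧ 2 * p.a = q.a then -4⁻¹ else 0 := by
  obtain ⟨l, rfl⟩ : ∃ k, l = k + 2 := ⟨l - 2, by omega⟩
  rw [coeff_psi, sum_range_succ', sum_range_succ', sum_eq_zero, zero_add, succMul_zero, add_comm]
  · congr 1
    · norm_num
    · have : NPlus.succMul (0 + 1) p = q ↔ p.b = 1 ∧ 2 * p.a = q.a := by
        rw [NPlus.ext_iff]
        simp only [NPlus.succMul, hq]
        omega
      rw [if_congr this rfl rfl]
      norm_num
  · intro i _
    refine if_neg ?_
    rintro rfl
    have h : (i + 1 + 1 + 1) * p.b = 2 := hq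
    nlinarith

variable (l : ℕ) (u : NPlus → ℚ)

theorem coeff_positivePart_of_level_one (hl : 1 ≤ l) (p : NPlus) {q : NPlus} (hq : q.b = 1) :
    coeff q (positivePart l u p) = if p = q then u q else 0 := by
  rw [positivePart]
  split_ifs with h0 h1 h1
  · rw [h1] at h0; omega
  · exact map_zero _
  · rw [map_smul, coeff_psi_of_level_one hl p hq, if_pos h1, h1, smul_eq_mul, mul_one]
  · rw [map_smul, coeff_psi_of_level_one hl p hq, if_neg h1, smul_zero]

theorem coeff_positivePart_of_level_two (hl : 2 ≤ l) (p : NPlus) {q : NPlus} (hq : q.b = 2) :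
    coeff q (positivePart l u p) = (if p = q then u q else 0) +
      if p.b = 1 ∧ 2 * p.a = q.a then -4⁻¹ * u p else 0 := by
  rw [positivePart]
  by_cases h0 : p.b = 0
  · rw [if_pos h0, if_neg (by rintro rfl; omega), if_neg (by omega)]
    simp
  · rw [if_neg h0, map_smul, coeff_psi_of_level_two hl (Nat.pos_of_ne_zero h0) hq, smul_eq_mul,
      mul_add]
    congr 1
    · split_ifs with h
      · rw [h, mul_one]
      · rw [mul_zero]
    · split_ifs with h
      · rw [mul_comm]
      · rw [mul_zero]

theorem coeff_lie_psi (p r q : NPlus) : coeff q ⁅psi l p, psi l r⁆ =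
    ∑ i ∈ range l, ∑ j ∈ range l,
      if NPlus.succMul i p + NPlus.succMul j r = q then
        ((-1 : ℚ) ^ (i + 2) / ((i : ℚ) + 1) ^ 2) * (((-1 : ℚ) ^ (j + 2) / ((j : ℚ) + 1) ^ 2) *
          NPlus.form (NPlus.succMul i p) (NPlus.succMul j r)) else 0 := by
  rw [psi, psi, sum_lie, map_sum]
  refine sum_congr rfl fun i _ => ?_
  rw [lie_sum, map_sum]
  refine sum_congr rfl fun j _ => ?_
  simp only [smul_lie, lie_smul, lie_X, map_smul, coeff_X, smul_eq_mul, mul_ite, mul_one, mul_zero]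
  split_ifs
  · ring
  · rfl

theorem coeff_lie_positivePart_of_level_one (p r : NPlus) {q : NPlus} (hq : q.b = 1) :
    coeff q ⁅positivePart l u p, positivePart l u r⁆ = 0 := by
  rw [positivePart, positivePart]
  split_ifs with hp hr hr
  · rw [zero_lie, map_zero]
  · rw [zero_lie, map_zero]
  · rw [lie_zero, map_zero]
  · rw [smul_lie, lie_smul, map_smul, map_smul, coeff_lie_psi, sum_eq_zero, smul_zero, smul_zero]
    intro i _
    refine sum_eq_zero fun j _ => if_neg ?_
    rintro rfl
    have h : (i + 1) * p.b + (j + 1) * r.b = 1 := hq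
    have h1 := Nat.mul_pos (Nat.succ_pos i) (Nat.pos_of_ne_zero hp)
    have h2 := Nat.mul_pos (Nat.succ_pos j) (Nat.pos_of_ne_zero hr)
    simp only [Nat.succ_eq_add_one] at h1 h2
    omega

theorem coeff_lie_positivePart_of_level_two (hl : 1 ≤ l) (p r : NPlus) {q : NPlus} (hq : q.b = 2) :
    coeff q ⁅positivePart l u p, positivePart l u r⁆ =
      if p.b = 1 ∧ r.b = 1 ∧ p.a + r.a = q.a then ((r.a : ℚ) - p.a) * (u p * u r) else 0 := by
  rw [positivePart, positivePart]
  by_cases hp : p.b = 0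
  · rw [if_pos hp, zero_lie, map_zero, if_neg (by omega)]
  by_cases hr : r.b = 0
  · rw [if_pos hr, lie_zero, map_zero, if_neg (by omega)]
  rw [if_neg hp, if_neg hr, smul_lie, lie_smul, map_smul, map_smul, coeff_lie_psi]
  -- Only the leading terms of both factors have level at most one.
  have h0 : ∀ i j, NPlus.succMul i p + NPlus.succMul j r = q → i = 0 ∧ j = 0 ∧ p.b = 1 ∧ r.b = 1 ∧
      p.a + r.a = q.a := by
    rintro i j rfl
    have h : (i + 1) * p.b + (j + 1) * r.b = 2 := hq
    have hp := Nat.pos_of_ne_zero hp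
    have hr := Nat.pos_of_ne_zero hr
    have hi : i = 0 := by nlinarith [Nat.zero_le (j * r.b), Nat.zero_le (i * p.b)]
    have hj : j = 0 := by nlinarith [Nat.zero_le (j * r.b), Nat.zero_le (i * p.b)]
    subst hi hj
    exact ⟨rfl, rfl, by omega, by omega, by simp [NPlus.succMul]⟩
  rw [sum_eq_single_of_mem 0 (mem_range.2 hl), sum_eq_single_of_mem 0 (mem_range.2 hl)]
  · have h1 : NPlus.succMul 0 p + NPlus.succMul 0 r = q ↔
        p.b = 1 ∧ r.b = 1 ∧ p.a + r.a = q.a := by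
      refine ⟨fun h => (h0 0 0 h).2.2, fun h => ?_⟩
      rw [succMul_zero, succMul_zero]
      ext
      · exact h.2.2
      · rw [NPlus.add_b, hq]; omega
    rw [if_congr h1 rfl rfl, succMul_zero, succMul_zero]
    split_ifs with h
    · simp only [NPlus.form, h.1, h.2.1, smul_eq_mul]
      push_cast
      ring
    · simp
  · intro j _ hj
    exact if_neg fun h => hj (h0 0 j h).2.1
  · intro i _ hi
    exact sum_eq_zero fun j _ => if_neg fun h => hi (h0 i j h).1

theorem coeff_conjPsi {m n : ℕ} {k j : ℕ} (hj : j < l) :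
    coeff ⟨k, j + 1, by omega⟩ (PoissonRep.conjPsi l m n) =
      n * ((-1 : ℚ) ^ (j + 2) / ((j : ℚ) + 1) ^ 2 * (((j + 1) * m).choose k : ℕ)) := by
  rw [PoissonRep.conjPsi, map_smul, smul_eq_mul, map_sum,
    sum_eq_single_of_mem j (mem_range.2 hj), map_smul, smul_eq_mul, map_sum]
  · simp only [map_smul, coeff_X, NPlus.mk.injEq, smul_eq_mul, and_true, mul_ite, mul_one, mul_zero,
      sum_ite_eq', mem_range]
    split_ifs with h
    · rfl
    · rw [Nat.choose_eq_zero_of_lt (by omega), Nat.cast_zero, mul_zero, mul_zero]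
  · intro i _ hi
    rw [map_smul, map_sum, sum_eq_zero, smul_zero]
    intro k' _
    rw [map_smul, coeff_X, if_neg (by rw [NPlus.mk.injEq]; omega), smul_zero]

theorem coeff_sum_sort (f : NPlus → GradedLie) (q : NPlus) :
    coeff q (((NPlus.degLE l).sort (· ≤ ·)).map f).sum = ∑ p ∈ NPlus.degLE l, coeff q (f p) := by
  rw [map_list_sum, List.map_map, ← List.sum_toFinset _ (Finset.sort_nodup _ _),
    Finset.sort_toFinset]
  rfl

theorem coeff_pairLie_of_level_one {q : NPlus} (hq : q.b = 1) (t : List NPlus) :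
    coeff q (pairLie (positivePart l u) t) = 0 := by
  induction t with
  | nil => exact map_zero _
  | cons p t ih =>
    rw [pairLie, map_add, ih, add_zero, map_list_sum]
    refine List.sum_eq_zero fun x hx => ?_
    obtain ⟨_, hy, rfl⟩ := List.mem_map.1 hx
    obtain ⟨r, -, rfl⟩ := List.mem_map.1 hy
    exact coeff_lie_positivePart_of_level_one l u p r hq

/-- For `q` of level two, the coefficient of `X_q` in the bracket of the positive parts at `p` and
`r`, with the factor `r.a - p.a` replaced by its absolute value. -/
def pairTerm (q p r : NPlus) : ℚ :=
  if p.b = 1 ∧ r.b = 1 ∧ p.a + r.a = q.a then |(r.a : ℚ) - p.a| * (u p * u r) else 0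

theorem pairTerm_comm (q p r : NPlus) : pairTerm u q p r = pairTerm u q r p := by
  rw [pairTerm, pairTerm, abs_sub_comm, mul_comm (u p), add_comm p.a]
  refine if_congr ?_ rfl rfl
  tauto

theorem pairTerm_self (q p : NPlus) : pairTerm u q p p = 0 := by
  simp [pairTerm]

/-- If `p` precedes `r` in an ordered list and both have level one, then `r.a - p.a ≤ 0`. Hence the
sum over the pairs in the order of the list is minus half the sum of the absolute values over all
pairs. -/
theorem coeff_pairLie_of_level_two (hl : 1 ≤ l) {q : NPlus} (hq : q.b = 2) (t : List NPlus)
    (ht : t.Pairwise (· ≤ ·)) :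
    coeff q (pairLie (positivePart l u) t) =
      -2⁻¹ * (t.map fun p => (t.map fun r => pairTerm u q p r).sum).sum := by
  induction t with
  | nil => simp [pairLie]
  | cons p t ih =>
    obtain ⟨hp, ht⟩ := List.pairwise_cons.1 ht
    have h1 : coeff q (t.map fun r => ⁅positivePart l u p, positivePart l u r⁆).sum =
        -1 * (t.map fun r => pairTerm u q p r).sum := by
      rw [map_list_sum, List.map_map, ← List.sum_map_mul_left]
      congr 1
      refine List.map_congr_left fun r hr => ?_
      rw [Function.comp_apply, coeff_lie_positivePart_of_level_two l u hl p r hq, pairTerm]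
      split_ifs with h
      · have h2 := (NPlus.le_iff p r).1 (hp r hr)
        have h3 : NPlus.form p r ≤ 0 := by omega
        simp only [NPlus.form, h.1, h.2.1, Nat.cast_one, one_mul, mul_one] at h3
        have h4 : (r.a : ℚ) - p.a ≤ 0 := by
          have : (r.a : ℤ) ≤ p.a := by linarith
          have : (r.a : ℚ) ≤ p.a := by exact_mod_cast this
          linarith
        rw [abs_of_nonpos h4]
        ring
      · simp
    have h2 : (t.map fun r => pairTerm u q r p).sum = (t.map fun r => pairTerm u q p r).sum := by
      congr 1
      exact List.map_congr_left fun r _ => pairTerm_comm u q r p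
    rw [pairLie, map_add, h1, ih ht]
    simp only [List.map_cons, List.sum_cons, pairTerm_self, List.sum_map_add, h2]
    ring

theorem sum_sort (f : NPlus → ℚ) :
    (((NPlus.degLE l).sort (· ≤ ·)).map f).sum = ∑ p ∈ NPlus.degLE l, f p := by
  rw [← List.sum_toFinset _ (Finset.sort_nodup _ _), Finset.sort_toFinset]

end GradedLie

/-! ### Recursion for the exponents of level two -/

namespace StructureGroup

open GradedLie Finset PoissonRep

variable {m n : ℕ} {u : NPlus → ℚ}

/-- The equation for the exponents, read off at the coefficient of `X_(k, b)` for `b = 1, 2`. -/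
theorem coeff_equation (hu : IsOrderedExponents m n u) {N k b : ℕ} (hk : k + 1 < N + 1)
    (hb : b < 3) (hb0 : 0 < b) :
    ∑ p ∈ NPlus.degLE (N + 2), coeff ⟨k, b, by omega⟩ (positivePart (N + 2) u p) +
      2⁻¹ * coeff ⟨k, b, by omega⟩
        (pairLie (positivePart (N + 2) u) ((NPlus.degLE (N + 2)).sort (· ≤ ·))) =
      coeff ⟨k, b, by omega⟩ (conjPsi (N + 2) m n) := by
  have h := congrArg (fun T => T (Pi.single (⟨1, by omega⟩, ⟨0, by omega⟩) 1)
    (⟨k + 1, hk⟩, ⟨b, hb⟩)) (rep_sum_positivePart (N := N) hu)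
  simp only [rep_apply_single hk hb hb0] at h
  have hb' : (b : ℚ) ≠ 0 := by
    have := hb0.ne'
    exact_mod_cast this
  rw [← mul_left_cancel₀ hb' h, map_add, map_smul, coeff_sum_sort, smul_eq_mul]

/-- The exponents of level one. -/
theorem exponent_level_one (hu : IsOrderedExponents m n u) (k : ℕ) :
    u ⟨k, 1, by omega⟩ = n * (m.choose k : ℚ) := by
  have h := coeff_equation hu (N := k + 1) (k := k) (b := 1) (by omega) (by omega) (by omega)
  rw [coeff_pairLie_of_level_one _ _ rfl, mul_zero, add_zero, coeff_conjPsi (j := 0) _ (by omega),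
    sum_congr rfl fun p _ => coeff_positivePart_of_level_one (k + 1 + 2) u (by omega) p
      (q := ⟨k, 1, by omega⟩) rfl, sum_ite_eq', if_pos] at h
  · rw [h]; norm_num
  · rw [NPlus.mem_degLE]
    simp only [NPlus.deg]
    omega

theorem sum_degLE_level_one {l a : ℕ} (hl : a < l) (f : ℕ → ℚ) :
    ∑ p ∈ NPlus.degLE l, (if p.b = 1 ∧ p.a ≤ a then f p.a else 0) = ∑ i ∈ range (a + 1), f i := by
  rw [← sum_filter]
  refine sum_bij' (fun p _ => p.a) (fun i _ => ⟨i, 1, by omega⟩) ?_ ?_ ?_ ?_ ?_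
  · intro p hp
    rw [mem_filter] at hp
    rw [mem_range]
    omega
  · intro i hi
    rw [mem_range] at hi
    rw [mem_filter, NPlus.mem_degLE]
    simp only [NPlus.deg]
    exact ⟨by omega, trivial, by omega⟩
  · intro p hp
    rw [mem_filter] at hp
    ext
    · rfl
    · exact hp.2.1.symm
  · intro i _; rfl
  · intro p _; rfl

/-- The exponents of level two. The first sum and the last term carry the coefficient `-1/4` of
`X_(2p)` in `log Ψ[p]`, for the factors `Ψ[(i, 1)]` on the right and for `Ψ[(0, 1)]` on the left; the
middle sum comes from the brackets of factors of level one. -/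
theorem exponent_level_two (hu : IsOrderedExponents m n u) (a : ℕ) :
    u ⟨a, 2, by omega⟩ = 4⁻¹ * (∑ i ∈ range (a + 1), if 2 * i = a then (n : ℚ) * m.choose i else 0) +
      4⁻¹ * (∑ i ∈ range (a + 1), |((a - i : ℕ) : ℚ) - i| *
        ((n * m.choose i) * (n * m.choose (a - i)))) - n * 4⁻¹ * (2 * m).choose a := by
  have h := coeff_equation hu (N := a + 1) (k := a) (b := 2) (by omega) (by omega) (by omega)
  rw [coeff_pairLie_of_level_two _ _ (by omega) rfl _ (Finset.pairwise_sort _ _),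
    coeff_conjPsi (j := 1) _ (by omega),
    sum_congr rfl fun p _ => coeff_positivePart_of_level_two (a + 1 + 2) u (by omega) p
      (q := ⟨a, 2, by omega⟩) rfl, sum_add_distrib, sum_ite_eq', if_pos, sum_sort,
      sum_congr rfl fun p _ => sum_sort _ _] at h
  · have h1 : ∑ p ∈ NPlus.degLE (a + 1 + 2), (if p.b = 1 ∧ 2 * p.a = a then -4⁻¹ * u p else 0) =
        -4⁻¹ * ∑ i ∈ range (a + 1), if 2 * i = a then (n : ℚ) * m.choose i else 0 := by
      rw [← sum_degLE_level_one (l := a + 1 + 2) (by omega), mul_sum]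
      refine sum_congr rfl fun p _ => ?_
      obtain ⟨i, b, hb⟩ := p
      by_cases hb1 : b = 1
      · subst hb1
        rw [exponent_level_one hu]
        simp only [true_and]
        by_cases h2 : 2 * i = a
        · rw [if_pos h2, if_pos (by omega), if_pos h2]
        · rw [if_neg h2, if_neg h2, ite_self, mul_zero]
      · rw [if_neg (by simp only; tauto), if_neg (by simp only; tauto), mul_zero]
    have h2 : ∀ p : NPlus, ∑ r ∈ NPlus.degLE (a + 1 + 2), pairTerm u ⟨a, 2, by omega⟩ p r =
        if p.b = 1 ∧ p.a ≤ a then |((a - p.a : ℕ) : ℚ) - p.a| *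
        ((n * m.choose p.a) * (n * m.choose (a - p.a))) else 0 := by
      intro p
      by_cases hp : p.b = 1 ∧ p.a ≤ a
      · rw [if_pos hp, sum_eq_single_of_mem ⟨a - p.a, 1, by omega⟩]
        · have hup : u p = n * (m.choose p.a : ℚ) := by
            rw [← exponent_level_one hu]
            congr 1
            ext
            · rfl
            · exact hp.1
          rw [pairTerm, if_pos, exponent_level_one hu, hup]
          exact ⟨hp.1, rfl, by simp only; omega⟩
        · rw [NPlus.mem_degLE]
          simp only [NPlus.deg]
          omega
        · intro r _ hr
          refine if_neg fun h => hr ?_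
          simp only at h
          ext
          · simp only; omega
          · exact h.2.1
      · rw [if_neg hp]
        refine sum_eq_zero fun r _ => if_neg fun h => hp ⟨h.1, ?_⟩
        simp only at h
        omega
    simp only at h
    rw [h1, sum_congr rfl fun p _ => h2 p, sum_degLE_level_one (l := a + 1 + 2) (by omega)
      (fun i => |((a - i : ℕ) : ℚ) - i| * ((n * m.choose i) * (n * m.choose (a - i))))] at h
    have h3 : ((1 + 1) * m).choose a = (2 * m).choose a := rfl
    rw [h3] at h
    push_cast at h ⊢
    linarith
  · rw [NPlus.mem_degLE]
    simp only [NPlus.deg]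
    omega

end StructureGroup

/-! ### Binomial identities -/

namespace BinomialSum

open Finset

/-- Counting pairs of subsets of sizes `i` and `a - i` by the size `k` of their union. -/
theorem choose_mul_choose_eq_sum (m a i : ℕ) (hi : i ≤ a) :
    m.choose i * m.choose (a - i) =
      ∑ k ∈ range (a + 1), m.choose k * (k.choose i * i.choose (a - k)) := by
  rcases Nat.lt_or_ge m i with h | h
  · rw [Nat.choose_eq_zero_of_lt h, zero_mul, sum_eq_zero]
    intro k _
    rcases Nat.lt_or_ge m k with h1 | h1
    · rw [Nat.choose_eq_zero_of_lt h1, zero_mul]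
    · rw [Nat.choose_eq_zero_of_lt (show k < i by omega), zero_mul, mul_zero]
  · have h1 : m.choose (a - i) =
        ∑ t ∈ range (a - i + 1), (m - i).choose t * i.choose (a - i - t) := by
      conv_lhs => rw [← Nat.sub_add_cancel h]
      rw [Nat.add_choose_eq, Nat.sum_antidiagonal_eq_sum_range_succ_mk]
    rw [h1, mul_sum, ← sum_range_add_sum_Ico _ (show i ≤ a + 1 by omega), sum_Ico_eq_sum_range,
      sum_eq_zero (s := range i), zero_add, show a + 1 - i = a - i + 1 by omega]
    · refine sum_congr rfl fun t _ => ?_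
      have h2 := Nat.choose_mul (n := m) (Nat.le_add_right i t)
      rw [Nat.add_sub_cancel_left] at h2
      rw [← mul_assoc, ← h2, mul_assoc, Nat.sub_sub]
    · intro k hk
      rw [mem_range] at hk
      rw [Nat.choose_eq_zero_of_lt hk, zero_mul, mul_zero]

/-- Only `a - k ≤ i ≤ k` contributes, and `i = a - k + s` turns the product of binomial
coefficients into a single one in `s`. -/
theorem sum_choose_mul_choose (a k : ℕ) (hk : k ≤ a) (f : ℕ → ℚ) :
    ∑ i ∈ range (a + 1), f i * (k.choose i * i.choose (a - k)) =
      if a ≤ 2 * k then (k.choose (2 * k - a) : ℚ) *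
        ∑ s ∈ range (2 * k - a + 1), f (a - k + s) * (2 * k - a).choose s else 0 := by
  have hsub : Ico (a - k) (k + 1) ⊆ range (a + 1) := fun i hi => by
    rw [mem_Ico] at hi; rw [mem_range]; omega
  rw [← sum_subset hsub]
  · split_ifs with h
    · rw [sum_Ico_eq_sum_range, mul_sum, show k + 1 - (a - k) = 2 * k - a + 1 by omega]
      refine sum_congr rfl fun s hs => ?_
      rw [mem_range] at hs
      have h1 := Nat.choose_mul (n := k) (k := a - k + s) (s := a - k) (by omega)
      rw [show k - (a - k) = 2 * k - a by omega, Nat.add_sub_cancel_left,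
        ← Nat.choose_symm (n := k) (k := a - k) (by omega),
        show k - (a - k) = 2 * k - a by omega] at h1
      have h2 : (k.choose (a - k + s) : ℚ) * ((a - k + s).choose (a - k) : ℚ) =
        (k.choose (2 * k - a) : ℚ) * ((2 * k - a).choose s : ℚ) := by exact_mod_cast h1
      rw [h2]
      ring
    · rw [Ico_eq_empty (by omega), sum_empty]
  · intro i _ hi
    rw [mem_Ico] at hi
    rcases Nat.lt_or_ge i (a - k) with h | h
    · rw [Nat.choose_eq_zero_of_lt h, Nat.cast_zero, mul_zero, mul_zero]
    · rw [Nat.choose_eq_zero_of_lt (show k < i by omega), Nat.cast_zero, zero_mul, mul_zero]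

theorem sum_mul_choose_mul_choose (m a : ℕ) (f : ℕ → ℚ) :
    ∑ i ∈ range (a + 1), f i * (m.choose i * m.choose (a - i)) =
      ∑ k ∈ range (a + 1), if a ≤ 2 * k then (m.choose k : ℚ) * (k.choose (2 * k - a) *
        ∑ s ∈ range (2 * k - a + 1), f (a - k + s) * (2 * k - a).choose s) else 0 := by
  have h1 : ∀ i ∈ range (a + 1), f i * (m.choose i * m.choose (a - i)) =
      ∑ k ∈ range (a + 1), (m.choose k : ℚ) * (f i * (k.choose i * i.choose (a - k))) := by
    intro i hi
    rw [mem_range] at hi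
    have h := choose_mul_choose_eq_sum m a i (by omega)
    have h' : (m.choose i : ℚ) * m.choose (a - i) =
        ∑ k ∈ range (a + 1), (m.choose k : ℚ) * (k.choose i * i.choose (a - k)) := by
      exact_mod_cast h
    rw [h', mul_sum]
    exact sum_congr rfl fun k _ => by ring
  rw [sum_congr rfl h1, sum_comm]
  refine sum_congr rfl fun k hk => ?_
  rw [mem_range] at hk
  rw [← mul_sum, sum_choose_mul_choose a k (by omega) f, mul_ite, mul_zero]

/-- The sum telescopes, as the summands are `(s + 1) * choose d (s + 1) - s * choose d s`. -/
theorem sum_range_sub_mul_choose (d h : ℕ) :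
    ∑ s ∈ range h, ((d : ℚ) - 2 * s) * d.choose s = h * d.choose h := by
  induction h with
  | zero => simp
  | succ h ih =>
    rw [sum_range_succ, ih]
    have h1 : ((d.choose (h + 1) : ℕ) : ℚ) * (h + 1) = d.choose h * ((d : ℚ) - h) := by
      rcases Nat.lt_or_ge d h with h2 | h2
      · rw [Nat.choose_eq_zero_of_lt h2, Nat.choose_eq_zero_of_lt (by omega)]
        simp
      · have h3 := Nat.choose_succ_right_eq d h
        rw [← Nat.cast_sub h2]
        exact_mod_cast h3
    push_cast
    linarith

/-- The sign of `d - 2 s` changes at `s = ⌈d / 2⌉`, and the sum without absolute values is zero. -/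
theorem sum_abs_sub_mul_choose (d : ℕ) :
    ∑ s ∈ range (d + 1), |(d : ℚ) - 2 * s| * d.choose s =
      2 * (((d + 1) / 2 : ℕ) * d.choose ((d + 1) / 2)) := by
  have h0 : ∑ s ∈ range (d + 1), ((d : ℚ) - 2 * s) * d.choose s = 0 := by
    rw [sum_range_sub_mul_choose, Nat.choose_succ_self, Nat.cast_zero, mul_zero]
  have hle : (d + 1) / 2 ≤ d + 1 := Nat.div_le_self _ _
  rw [← sum_range_add_sum_Ico _ hle, sum_range_sub_mul_choose] at h0
  rw [← sum_range_add_sum_Ico _ hle]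
  have h1 : ∑ s ∈ range ((d + 1) / 2), |(d : ℚ) - 2 * s| * d.choose s =
      ((d + 1) / 2 : ℕ) * d.choose ((d + 1) / 2) := by
    rw [← sum_range_sub_mul_choose]
    refine sum_congr rfl fun s hs => ?_
    rw [mem_range] at hs
    have : ((2 * s : ℕ) : ℚ) ≤ d := by exact_mod_cast (show 2 * s ≤ d by omega)
    push_cast at this
    rw [abs_of_nonneg (by linarith)]
  have h2 : ∑ s ∈ Ico ((d + 1) / 2) (d + 1), |(d : ℚ) - 2 * s| * d.choose s =
      -∑ s ∈ Ico ((d + 1) / 2) (d + 1), ((d : ℚ) - 2 * s) * d.choose s := by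
    rw [← sum_neg_distrib]
    refine sum_congr rfl fun s hs => ?_
    rw [mem_Ico] at hs
    have : (d : ℚ) ≤ ((2 * s : ℕ) : ℚ) := by exact_mod_cast (show d ≤ 2 * s by omega)
    push_cast at this
    rw [abs_of_nonpos (by linarith), neg_mul]
  rw [h1, h2]
  linarith

theorem half_succ_mul_choose (d : ℕ) (hd : 0 < d) :
    (((d + 1) / 2 : ℕ) : ℚ) * d.choose ((d + 1) / 2) = d * (d - 1).choose (d / 2) := by
  obtain ⟨e, rfl⟩ : ∃ e, d = e + 1 := ⟨d - 1, by omega⟩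
  have h1 := Nat.add_one_mul_choose_eq e (e / 2)
  have h2 := Nat.choose_symm (n := e) (k := e / 2) (Nat.div_le_self _ _)
  rw [show e - e / 2 = (e + 1) / 2 by omega] at h2
  rw [show (e + 1 + 1) / 2 = e / 2 + 1 by omega, Nat.add_sub_cancel, h2, mul_comm]
  exact_mod_cast h1.symm

theorem ceil_half (d : ℕ) : ⌈(d : ℚ) / 2⌉₊ = (d + 1) / 2 := by
  refine le_antisymm (Nat.ceil_le.2 ?_) ?_
  · rw [div_le_iff₀ (by norm_num)]
    exact_mod_cast (show d ≤ (d + 1) / 2 * 2 by omega)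
  · have h := Nat.le_ceil ((d : ℚ) / 2)
    rw [div_le_iff₀ (by norm_num)] at h
    have h' : d ≤ ⌈(d : ℚ) / 2⌉₊ * 2 := by exact_mod_cast h
    omega

end BinomialSum

/-! ### The formula -/

namespace StructureGroup

open Finset BinomialSum

/-- The exponents of level two expanded in the binomial coefficients `choose m k`. -/
theorem exponent_level_two_eq_sum {m n : ℕ} {u : NPlus → ℚ} (hu : IsOrderedExponents m n u)
    (a : ℕ) : u ⟨a, 2, by omega⟩ = ∑ k ∈ range (a + 1), if a ≤ 2 * k then
      (m.choose k : ℚ) * k.choose (2 * k - a) *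
        (2⁻¹ * (n : ℚ) ^ 2 *
            (((2 * k - a + 1) / 2 : ℕ) * (2 * k - a).choose ((2 * k - a + 1) / 2)) -
          (n : ℚ) * 4⁻¹ * 2 ^ (2 * k - a) + if 2 * k = a then (n : ℚ) * 4⁻¹ else 0) else 0 := by
  have h1 : ∑ i ∈ range (a + 1), |((a - i : ℕ) : ℚ) - i| *
      ((n * m.choose i) * (n * m.choose (a - i))) =
      n ^ 2 * ∑ i ∈ range (a + 1), |((a - i : ℕ) : ℚ) - i| *
        (m.choose i * m.choose (a - i)) := by
    rw [mul_sum]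
    exact sum_congr rfl fun i _ => by ring
  have h2 : ((2 * m).choose a : ℚ) =
      ∑ i ∈ range (a + 1), (1 : ℚ) * (m.choose i * m.choose (a - i)) := by
    rw [two_mul, Nat.add_choose_eq, Nat.sum_antidiagonal_eq_sum_range_succ_mk]
    push_cast
    exact sum_congr rfl fun i _ => (one_mul _).symm
  rw [exponent_level_two hu, h1, h2, sum_mul_choose_mul_choose, sum_mul_choose_mul_choose]
  simp only [mul_sum]
  rw [← sum_add_distrib, ← sum_sub_distrib]
  refine sum_congr rfl fun k hk => ?_
  rw [mem_range] at hk
  by_cases h : a ≤ 2 * k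
  · have h3 : ∑ s ∈ range (2 * k - a + 1), |((a - (a - k + s) : ℕ) : ℚ) - ((a - k + s : ℕ) : ℚ)| *
        ((2 * k - a).choose s : ℚ) =
        2 * (((2 * k - a + 1) / 2 : ℕ) * (2 * k - a).choose ((2 * k - a + 1) / 2)) := by
      rw [← sum_abs_sub_mul_choose]
      refine sum_congr rfl fun s hs => ?_
      rw [mem_range] at hs
      congr 2
      rw [Nat.cast_sub (show a - k + s ≤ a by omega), Nat.cast_add,
        Nat.cast_sub (show k ≤ a by omega), Nat.cast_sub h]
      push_cast
      ring
    have h4 : ∑ s ∈ range (2 * k - a + 1), (1 : ℚ) * ((2 * k - a).choose s : ℚ) =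
        2 ^ (2 * k - a) := by
      simp only [one_mul]
      exact_mod_cast Nat.sum_range_choose (2 * k - a)
    rw [if_pos h, if_pos h, if_pos h, ← mul_sum, ← mul_sum, ← mul_sum, ← mul_sum, h3, h4]
    by_cases h5 : 2 * k = a
    · rw [if_pos h5, if_pos h5, show 2 * k - a = 0 by omega]
      simp
      ring
    · rw [if_neg h5, if_neg h5]
      ring
  · rw [if_neg h, if_neg h, if_neg h, if_neg (by omega)]
    ring

end StructureGroup

theorem mainTheorem2 (a : ℕ) (ha : 0 < a) (m n : ℕ) :
    (∃! u : NPlus → ℚ, StructureGroup.IsOrderedExponents m n u) ∧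
    ∀ u : NPlus → ℚ, StructureGroup.IsOrderedExponents m n u →
      u ⟨a, 2, by omega⟩ =
        (∑ k ∈ (Finset.Icc 1 a).filter (fun k : ℕ => (a : ℚ) / 2 < (k : ℚ)),
          (⌈(2 * (k : ℚ) - (a : ℚ)) / 2⌉₊ : ℚ) *
            (Nat.choose (2 * k - a) ⌈(2 * (k : ℚ) - (a : ℚ)) / 2⌉₊ : ℚ) *
            (Nat.choose k (2 * k - a) : ℚ) * (Nat.choose m k : ℚ) * (Nat.choose n 2 : ℚ)) +
        ∑ k ∈ (Finset.Icc 1 a).filter (fun k : ℕ => (a : ℚ) / 2 + 1 < (k : ℚ)),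
          ((2 * (k : ℚ) - (a : ℚ)) / 2 *
              (Nat.choose (2 * k - a - 1) ⌈(2 * (k : ℚ) - (a : ℚ) - 1) / 2⌉₊ : ℚ) -
              (2 : ℚ) ^ (2 * k - a - 2)) *
            (Nat.choose k (2 * k - a) : ℚ) * (Nat.choose m k : ℚ) * (Nat.choose n 1 : ℚ) := by
  refine ⟨StructureGroup.existsUnique_orderedProd _, fun u hu => ?_⟩
  rw [StructureGroup.exponent_level_two_eq_sum hu]
  have hcond1 : ∀ k : ℕ, (a : ℚ) / 2 < k ↔ a < 2 * k := fun k => by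
    rw [div_lt_iff₀ (by norm_num), mul_comm]
    exact_mod_cast Iff.rfl
  have hcond2 : ∀ k : ℕ, (a : ℚ) / 2 + 1 < k ↔ a + 2 < 2 * k := fun k => by
    rw [show (a : ℚ) / 2 + 1 = (a + 2) / 2 by ring, div_lt_iff₀ (by norm_num), mul_comm]
    exact_mod_cast Iff.rfl
  have hset1 : (Finset.Icc 1 a).filter (fun k : ℕ => (a : ℚ) / 2 < (k : ℚ)) =
      (Finset.range (a + 1)).filter fun k => a < 2 * k := by
    ext k
    simp only [Finset.mem_filter, Finset.mem_Icc, Finset.mem_range, hcond1]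
    omega
  have hset2 : (Finset.Icc 1 a).filter (fun k : ℕ => (a : ℚ) / 2 + 1 < (k : ℚ)) =
      (Finset.range (a + 1)).filter fun k => a + 2 < 2 * k := by
    ext k
    simp only [Finset.mem_filter, Finset.mem_Icc, Finset.mem_range, hcond2]
    omega
  -- Both sums are now indexed like the expansion in `choose m k`; they are compared termwise, with
  -- `d = 2 * k - a`.
  rw [hset1, hset2, Finset.sum_filter, Finset.sum_filter, ← Finset.sum_add_distrib]
  refine Finset.sum_congr rfl fun k _ => ?_
  by_cases h : a ≤ 2 * k
  · obtain ⟨d, hd⟩ : ∃ d, 2 * k = a + d := ⟨2 * k - a, by omega⟩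
    have hdQ : 2 * (k : ℚ) - a = d := by
      have : (2 * (k : ℚ)) = a + d := by exact_mod_cast hd
      linarith
    have hd' : 2 * k - a = d := by omega
    have hn : (n.choose 2 : ℚ) = 2⁻¹ * n ^ 2 - 2⁻¹ * n := by
      rw [Nat.cast_choose_two]; ring
    rw [if_pos h, hd', hdQ, BinomialSum.ceil_half, hn, Nat.choose_one_right]
    rcases Nat.lt_or_ge 2 d with h3 | h3
    · have hceil : ⌈((d : ℚ) - 1) / 2⌉₊ = d / 2 := by
        rw [← Nat.cast_pred (by omega), BinomialSum.ceil_half, Nat.sub_add_cancel (by omega)]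
      have hpow : (2 : ℚ) ^ d = 4 * 2 ^ (d - 2) := by
        conv_lhs => rw [← Nat.sub_add_cancel (show 2 ≤ d by omega), pow_add]
        ring
      rw [if_neg (by omega), if_pos (by omega), if_pos (by omega), hceil, hpow]
      have hmid := BinomialSum.half_succ_mul_choose d (by omega)
      linear_combination (2⁻¹ * (m.choose k : ℚ) * k.choose d * n) * hmid
    · rw [if_neg (show ¬a + 2 < 2 * k by omega)]
      -- For `d ≤ 2` the coefficient of `choose n 1` vanishes.
      interval_cases d
      · rw [if_pos (by omega), if_neg (by omega)]
        norm_num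
      · rw [if_neg (by omega), if_pos (by omega)]
        norm_num
        ring
      · rw [if_neg (by omega), if_pos (by omega)]
        norm_num
        ring
  · rw [if_neg h, if_neg (by omega), if_neg (by omega), add_zero]
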